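/- There is a deterministic algorithm $\mathcal A$ for the asynchronous crash-prone model ASYNC LOCAL that properly 5-colors all cycles in $O(\log^* n)$ rounds. In detail: Model. The $n\ge 3$ nodes of the cycle $C_n$ have pairwise distinct identifiers in $[1,N]$, and every node is given $N$ as input; the nodes know neither $n$ nor the graph. Every node $v$ has a register, initially $\bot$, that only its neighbors can read, and a current state, initially a function of its identifier and of $N$. A scheduling is an arbitrary sequence $S_1,S_2,\dots$ of sets of nodes. At step $i$, all nodes of $S_i$ write their current states in their registers, then they all read the registers of their neighbors, and then each of them computes its new state as a fixed function of the state it has just written and of the set of register contents it has read; the other nodes do nothing. A special state $\mathsf{term}(x)$ means that the node has terminated with output $x$; it never changes. The runtime of a node is the number of steps at which it is scheduled while it has not terminated. Claim. There is a single such algorithm $\mathcal A$ with outputs in a palette of 5 colors such that: 1. for all $n\ge 3$ and $N$, all identifiers as above and every scheduling, at any time any two adjacent nodes that have both terminated have different outputs; 2. for every $k$ there is a constant $C$ such that, for all $n\ge 3$ and $N\le n^k$, all identifiers as above and every scheduling, the runtime of every node is at most $C\cdot\log^* n$. Here $\log^* n$ is the number of times $\log_2$ has to be applied to $n$ until the value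 is at most $1$. -/

import Mathlib

namespace AsyncLocal

/-- The state of a node: either still running, with a local state in `σ`, or the special
state in which the node has terminated with an output in `X`. A terminated state carries the
output and nothing else. -/
inductive NodeState (σ X : Type) : Type
  | running (s : σ) : NodeState σ X
  | terminated (x : X) : NodeState σ X

/-- A deterministic algorithm for the ASYNC LOCAL model with inputs in `I` and outputs in `X`.
* `init` gives the initial state of a node from its identifier and its input;
* `next` gives the new state of a running node from the state that it has just written and the
  set of contents of its neighbors' registers. A register that was never written contains
  `none`. The nodes have no other access to the graph. -/
structure Algorithm (I X : Type) where
  State : Type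
  init : ℕ → I → NodeState State X
  next : State → Set (Option (NodeState State X)) → NodeState State X

variable {I X : Type} {V : Type}

/-- A global configuration: `old v` is the content of the register of `v`, the value that the
neighbors of `v` read (`none` if `v` has not written yet), and `new v` is the current state
of `v`, which becomes visible the next time `v` is activated. -/
structure Config (A : Algorithm I X) (V : Type) where
  old : V → Option (NodeState A.State X)
  new : V → NodeState A.State X

/-- The update of a state that has just been written, given the set of register contents
that were read. A terminated node never changes its state. -/
def Algorithm.update (A : Algorithm I X) :
    NodeState A.State X → Set (Option (NodeState A.State X)) → NodeState A.State X
  | .running s, R => A.next s R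
  | .terminated x, _ => .terminated x

open Classical in
/-- One step, in which the nodes of `S` are activated: all of them write their states, then all
of them read the registers of their neighbors, and then they update their states. -/
noncomputable def Algorithm.step (A : Algorithm I X) (G : SimpleGraph V) (S : Set V)
    (c : Config A V) : Config A V :=
  let old' : V → Option (NodeState A.State X) :=
    fun v => if v ∈ S then some (c.new v) else c.old v
  { old := old'
    new := fun v =>
      if v ∈ S then A.update (c.new v) {r | ∃ u, G.Adj v u ∧ old' u = r} else c.new v }

/-- The execution of `A` on the graph `G` with identifiers `ident` and inputs `inp` under the
scheduling `S 0, S 1, S 2, …`, which is an arbitrary sequence of sets of nodes;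
`A.exec G ident inp S t` is the configuration just before step `t`. -/
noncomputable def Algorithm.exec (A : Algorithm I X) (G : SimpleGraph V) (ident : V → ℕ)
    (inp : V → I) (S : ℕ → Set V) : ℕ → Config A V
  | 0 => { old := fun _ => none
           new := fun v => A.init (ident v) (inp v) }
  | t + 1 => A.step G (S t) (A.exec G ident inp S t)

/-- In the given execution, node `v` has terminated with output `x` before step `t`. -/
def Algorithm.Outputs (A : Algorithm I X) (G : SimpleGraph V) (ident : V → ℕ)
    (inp : V → I) (S : ℕ → Set V) (t : ℕ) (v : V) (x : X) : Prop :=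
  (A.exec G ident inp S t).new v = .terminated x

/-- The runtime of a node `v` in the given execution: the number of steps at which `v` is
activated while it has not terminated (possibly infinite). -/
noncomputable def Algorithm.runtime (A : Algorithm I X) (G : SimpleGraph V) (ident : V → ℕ)
    (inp : V → I) (S : ℕ → Set V) (v : V) : ℕ∞ :=
  Set.encard {t : ℕ | v ∈ S t ∧ ∀ x : X, ¬ A.Outputs G ident inp S t v x}

/-- The outputs of the given execution form a proper coloring: at every time, any two adjacent
nodes that have both terminated have different outputs. -/
def Algorithm.ProperlyColors (A : Algorithm I X) (G : SimpleGraph V) (ident : V → ℕ)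
    (inp : V → I) (S : ℕ → Set V) : Prop :=
  ∀ (t : ℕ) (u v : V) (x y : X), G.Adj u v →
    A.Outputs G ident inp S t u x → A.Outputs G ident inp S t v y → x ≠ y

/-- The identifiers are pairwise distinct and lie in the integer interval `[1, N]`. -/
def ValidIds (N : ℕ) (ident : V → ℕ) : Prop :=
  Function.Injective ident ∧ ∀ v, 1 ≤ ident v ∧ ident v ≤ N

/-- The iterated logarithm in base 2: the number of times `log₂` has to be applied to `n` until
the value is at most `1`. (Rounding the logarithms up does not change this number.) -/
def logStar (n : ℕ) : ℕ :=
  if n ≤ 1 then 0 else logStar (Nat.clog 2 n) + 1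
termination_by n
decreasing_by
  have h : n ≤ 2 ^ (n - 1) := by
    have := Nat.lt_two_pow_self (n := n - 1)
    omega
  have := Nat.clog_le_of_le_pow h
  omega

end AsyncLocal

/-! ### Records and the rule for proposed colors. -/

namespace AsyncLocal
namespace FiveColoring

/-! The algorithm has two phases, and in neither does a node wait for its neighbors.

Phase one turns the identifiers into keys of at most ten bits that differ between neighbors. A node
whose color x has B bits moves to a pair of bit positions together with the bits of x there.
Positions that separate x from the colors of its two neighbors give a value that neither neighbor
can choose (`exists_cand`). Nodes keep the history of their colors, so of two neighbors the later
one to make a given step sees the color that the other one started from (`Inv.step`). The number of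
bits drops from B to about 2 log B, which gives O(log* n) stages (`rounds_le_logStar`).

In phase two a node shows a record with a proposed color, terminates if neither neighbor shows that
color, and otherwise computes a new record from what it reads. Safety is easy, because a node has
shown its color before it terminates with it (`done_ne`). The runtime rests on two facts. First, a
color computed from the current displays is shown by neither neighbor (`view_color_ne`), so a node
that acts again before a neighbor's display changes terminates. Second, the entries of records
depend on each other without cycles: a on smaller keys, b on larger keys, then g, then c. As the
keys are bounded, each display changes boundedly often (`changes_mask_le`).

For the palette, colors 0, 1, 2, 3 encode (a, b) = (0, 0), (1, 0), (0, 1), (1, 1). A node with b = 2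
takes the color g that its larger neighbor with b = 0 has left free. A node with two smaller
neighbors picks from 0, 1, 4. The last case, `color_ne_of_small`, is the delicate one. -/

/-- What a node displays once it has a final key: its key, two coordinates `a` and `b`, the
color `g` that it leaves to a smaller neighbor, and the color `c` that it proposes. -/
structure Rec where
  key : ℕ
  a : ℕ
  b : ℕ
  g : Fin 5
  c : Fin 5

/-- The part of the content of a register that matters for the reduction to five colors. -/
inductive Disp : Type
  | absent
  | done (x : Fin 5)
  | live (r : Rec)

namespace Disp

/-- A smaller neighbor; terminated neighbors count as smaller. -/
def IsSmall (k : ℕ) : Disp → Prop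
  | absent => False
  | done _ => True
  | live r => r.key < k

def IsLarge (k : ℕ) : Disp → Prop
  | live r => k < r.key
  | _ => False

/-- A smaller neighbor with first coordinate `0`. -/
def ZeroA (k : ℕ) : Disp → Prop
  | absent => False
  | done x => x = 0 ∨ x = 2
  | live r => r.key < k ∧ r.a = 0

def LargeB (k j : ℕ) : Disp → Prop
  | live r => k < r.key ∧ r.b = j
  | _ => False

def LowOne : Disp → Prop
  | absent => False
  | done x => x = 1
  | live r => r.b = 0 ∧ r.a = 1

def LowZero : Disp → Prop
  | live r => r.b = 0 ∧ r.a = 0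
  | _ => False

def IsDoneZero : Disp → Prop
  | done x => x = 0
  | _ => False

def color : Disp → Option (Fin 5)
  | absent => none
  | done x => some x
  | live r => some r.c

def left : Disp → Fin 5
  | live r => r.g
  | _ => 4

end Disp

open Disp
open scoped Classical

/-- A color in `{0, 1, 4}` different from `g` and, if possible, from `x` and `y`. -/
noncomputable def pick (g : Fin 5) (x y : Option (Fin 5)) : Fin 5 :=
  if g ≠ 1 ∧ x ≠ some 1 ∧ y ≠ some 1 then 1
  else if g ≠ 0 ∧ x ≠ some 0 ∧ y ≠ some 0 then 0
  else if g = 4 then 0 else 4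

/-- With exactly one smaller neighbor, this avoids its first coordinate. A terminated neighbor no
longer shows coordinates; its color is read as a = 0 when it is 0 or 2, the colors of the pairs with
a = 0. -/
noncomputable def aVal (k : ℕ) (d e : Disp) : ℕ :=
  if IsSmall k d ∧ IsSmall k e then 0 else if ZeroA k d ∨ ZeroA k e then 1 else 0

/-- The least value that no larger neighbor shows as its b. -/
noncomputable def bVal (k : ℕ) (d e : Disp) : ℕ :=
  if LargeB k 0 d ∨ LargeB k 0 e then (if LargeB k 1 d ∨ LargeB k 1 e then 2 else 1) else 0

/-- With two smaller neighbors, the case distinction ensures that they never show both of the other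
colors in {0, 1, 4}, so that `pick` succeeds. -/
noncomputable def gVal (k : ℕ) (d e : Disp) : Fin 5 :=
  if IsSmall k d ∧ IsSmall k e then
    if IsDoneZero d ∨ IsDoneZero e then 0
    else if LowOne d ∨ LowOne e then 1
    else if LowZero d ∨ LowZero e then 0 else 4
  else if aVal k d e = 1 then 0 else 4

/-- In the branch for the pair (1, 0), color 4 is an escape for when the smaller neighbor shows 1.
It is allowed only in the presence of a larger neighbor, which `c_eq_one_of_small` exploits. -/
noncomputable def cVal (k : ℕ) (d e : Disp) : Fin 5 :=
  if IsSmall k d ∧ IsSmall k e then pick (gVal k d e) d.color e.color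
  else if bVal k d e = 2 then (if LargeB k 0 d then d.left else e.left)
  else if bVal k d e = 1 then (if aVal k d e = 0 then 2 else 3)
  else if aVal k d e = 0 then 0
  else if (IsLarge k d ∨ IsLarge k e) ∧
      ((IsSmall k d ∧ d.color = some 1) ∨ (IsSmall k e ∧ e.color = some 1)) then 4
  else 1

/-- The record of a node with key `k` whose neighbors display `d` and `e`. -/
noncomputable def mkRec (k : ℕ) (d e : Disp) : Rec :=
  ⟨k, aVal k d e, bVal k d e, gVal k d e, cVal k d e⟩

lemma pick_comm (g x y) : pick g x y = pick g y x := by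
  unfold pick
  simp only [and_comm (a := x ≠ some 1) (b := y ≠ some 1),
    and_comm (a := x ≠ some 0) (b := y ≠ some 0)]

lemma Disp.LargeB.unique {k i j d} (h : LargeB k i d) (h' : LargeB k j d) : i = j := by
  cases d <;> simp_all [LargeB]

lemma aVal_comm (k d e) : aVal k d e = aVal k e d := by
  exact if_congr and_comm rfl (if_congr or_comm rfl rfl)

lemma bVal_comm (k d e) : bVal k d e = bVal k e d := by
  exact if_congr or_comm (if_congr or_comm rfl rfl) rfl

lemma gVal_comm (k d e) : gVal k d e = gVal k e d := by
  unfold gVal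
  rw [aVal_comm]
  exact if_congr and_comm (if_congr or_comm rfl (if_congr or_comm rfl (if_congr or_comm rfl rfl)))
    rfl

lemma bVal_eq_two {k d e} (h : bVal k d e = 2) :
    (LargeB k 0 d ∧ LargeB k 1 e) ∨ (LargeB k 0 e ∧ LargeB k 1 d) := by
  unfold bVal at h
  split_ifs at h with h1 h2
  on_goal 2 => omega
  rcases h1 with h1 | h1 <;> rcases h2 with h2 | h2
  · exact absurd (h1.unique h2) (by norm_num)
  · exact .inl ⟨h1, h2⟩
  · exact .inr ⟨h1, h2⟩
  · exact absurd (h1.unique h2) (by norm_num)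

/-- Nodes read an unordered set of registers, so the rule must be symmetric. The only asymmetric
branch is b = 2, where exactly one neighbor is larger with b = 0. -/
lemma cVal_comm (k d e) : cVal k d e = cVal k e d := by
  unfold cVal
  rw [aVal_comm k d e, gVal_comm k d e, bVal_comm k d e, pick_comm]
  refine if_congr and_comm rfl ?_
  by_cases h : bVal k e d = 2
  · rw [if_pos h, if_pos h]
    rcases bVal_eq_two h with h' | h'
    · have : ¬ LargeB k 0 d := fun h2 => absurd (h2.unique h'.2) (by norm_num)
      rw [if_pos h'.1, if_neg this]
    · have : ¬ LargeB k 0 e := fun h2 => absurd (h2.unique h'.2) (by norm_num)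
      rw [if_pos h'.1, if_neg this]
  · rw [if_neg h, if_neg h]
    exact if_congr Iff.rfl rfl (if_congr Iff.rfl rfl
      (if_congr (and_congr or_comm or_comm) rfl rfl))

lemma mkRec_comm (k d e) : mkRec k d e = mkRec k e d := by
  simp only [mkRec, aVal_comm k d e, bVal_comm k d e, gVal_comm k d e, cVal_comm k d e]

lemma Disp.LargeB.isLarge {k j d} (h : LargeB k j d) : IsLarge k d := by
  cases d <;> simp_all [LargeB, IsLarge]

lemma Disp.ZeroA.isSmall {k d} (h : ZeroA k d) : IsSmall k d := by
  cases d <;> simp_all [ZeroA, IsSmall]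

lemma Disp.IsLarge.not_isSmall {k d} (h : IsLarge k d) : ¬ IsSmall k d := by
  cases d <;> simp_all [IsLarge, IsSmall]; omega

lemma aVal_le (k d e) : aVal k d e = 0 ∨ aVal k d e = 1 := by
  unfold aVal; split_ifs <;> simp

lemma bVal_le (k d e) : bVal k d e = 0 ∨ bVal k d e = 1 ∨ bVal k d e = 2 := by
  unfold bVal; split_ifs <;> simp

lemma aVal_eq_one {k d e} (h : aVal k d e = 1) :
    ¬ (IsSmall k d ∧ IsSmall k e) ∧ (ZeroA k d ∨ ZeroA k e) := by
  unfold aVal at h; split_ifs at h with h1 h2; exact ⟨h1, h2⟩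

lemma gVal_eq_one {k d e} (h : gVal k d e = 1) :
    (IsSmall k d ∧ IsSmall k e) ∧ (LowOne d ∨ LowOne e) := by
  unfold gVal at h
  split_ifs at h <;> simp_all

lemma gVal_mem (k d e) : gVal k d e = 0 ∨ gVal k d e = 1 ∨ gVal k d e = 4 := by
  unfold gVal; split_ifs <;> simp

lemma bVal_of_small {k d e} (h : IsSmall k d) (h' : IsSmall k e) : bVal k d e = 0 := by
  unfold bVal
  rw [if_neg]
  rintro (h2 | h2)
  · exact h2.isLarge.not_isSmall h
  · exact h2.isLarge.not_isSmall h'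

lemma bVal_of_not_large {k d e} (h : ¬ IsLarge k d) (h' : ¬ IsLarge k e) : bVal k d e = 0 := by
  unfold bVal
  rw [if_neg]
  rintro (h2 | h2)
  · exact h h2.isLarge
  · exact h' h2.isLarge

lemma cVal_of_bVal_one {k d e} (h : bVal k d e = 1) :
    cVal k d e = if aVal k d e = 0 then 2 else 3 := by
  have h1 : ¬ (IsSmall k d ∧ IsSmall k e) := fun h2 => by
    rw [bVal_of_small h2.1 h2.2] at h; omega
  simp [cVal, h1, h]

lemma cVal_of_bVal_zero {k d e} (h1 : ¬ (IsSmall k d ∧ IsSmall k e)) (h : bVal k d e = 0) :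
    cVal k d e = if aVal k d e = 0 then 0
      else if (IsLarge k d ∨ IsLarge k e) ∧
        ((IsSmall k d ∧ d.color = some 1) ∨ (IsSmall k e ∧ e.color = some 1)) then 4
      else 1 := by
  simp [cVal, h1, h]

lemma pick_mem (g x y) : pick g x y = 0 ∨ pick g x y = 1 ∨ pick g x y = 4 := by
  unfold pick; split_ifs <;> simp

lemma pick_ne (g x y) : pick g x y ≠ g := by
  unfold pick; split_ifs with h1 h2 h3
  · exact h1.1.symm
  · exact h2.1.symm
  · rw [h3]; decide
  · exact fun h => h3 h.symm

lemma cVal_mem {k d e} (h : bVal k d e = 0) :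
    cVal k d e = 0 ∨ cVal k d e = 1 ∨ cVal k d e = 4 := by
  by_cases h1 : IsSmall k d ∧ IsSmall k e
  · have : cVal k d e = pick (gVal k d e) d.color e.color := by unfold cVal; rw [if_pos h1]
    rw [this]; exact pick_mem ..
  · rw [cVal_of_bVal_zero h1 h]; split_ifs <;> simp

lemma cVal_ne_gVal {k d e} (h : bVal k d e = 0) : cVal k d e ≠ gVal k d e := by
  by_cases h1 : IsSmall k d ∧ IsSmall k e
  · have : cVal k d e = pick (gVal k d e) d.color e.color := by unfold cVal; rw [if_pos h1]
    rw [this]; exact pick_ne _ _ _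
  · rw [cVal_of_bVal_zero h1 h]
    unfold gVal
    rw [if_neg h1]
    rcases aVal_le k d e with h2 | h2 <;> simp only [h2] <;> split_ifs <;> simp_all

/-- `pick` can only fail to avoid a neighbor when the neighbors exhaust the choices. -/
lemma pick_bad {g : Fin 5} {x y : Option (Fin 5)} (hg : g = 0 ∨ g = 1 ∨ g = 4)
    (h : x = some (pick g x y) ∨ y = some (pick g x y)) :
    ∀ z : Fin 5, (z = 0 ∨ z = 1 ∨ z = 4) → z ≠ g → x = some z ∨ y = some z := by
  unfold pick at h
  intro z hz hzg
  by_contra! hc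
  rcases hg with rfl | rfl | rfl <;> rcases hz with rfl | rfl | rfl <;>
    split_ifs at h <;> simp_all

end FiveColoring
end AsyncLocal

/-! ### Executions of the second phase, and safety. -/

namespace AsyncLocal
namespace FiveColoring
open Disp
open scoped Classical

/-- The displays of the nodes during an execution: `D v t` is what the register of `v` displays
just before step `t`, and `P v t` is what `v` writes the next time it is activated. -/
structure Run (V : Type) where
  S : ℕ → Set V
  nl : V → V
  nr : V → V
  key : V → ℕ
  bound : ℕ
  D : V → ℕ → Disp
  P : V → ℕ → Disp
  D_zero : ∀ v, D v 0 = absent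
  P_zero : ∀ v, P v 0 = absent
  D_idle : ∀ v t, v ∉ S t → D v (t + 1) = D v t
  P_idle : ∀ v t, v ∉ S t → P v (t + 1) = P v t
  D_write : ∀ v t, v ∈ S t → D v (t + 1) = P v t
  P_done : ∀ v t x, v ∈ S t → P v t = done x → P v (t + 1) = done x
  P_absent : ∀ v t, v ∈ S t → P v t = absent → P v (t + 1) = absent ∨
    P v (t + 1) = live (mkRec (key v) (D (nl v) (t + 1)) (D (nr v) (t + 1)))
  P_live : ∀ v t r, v ∈ S t → P v t = live r → P v (t + 1) =
    if (D (nl v) (t + 1)).color ≠ some r.c ∧ (D (nr v) (t + 1)).color ≠ some r.c then done r.c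
    else live (mkRec (key v) (D (nl v) (t + 1)) (D (nr v) (t + 1)))
  key_lt : ∀ v, key v < bound
  symm : ∀ u v, (u = nl v ∨ u = nr v) → (v = nl u ∨ v = nr u)
  key_ne : ∀ u v t r q, (u = nl v ∨ u = nr v) → D u t = live r → D v t = live q →
    key u ≠ key v

namespace Run

variable {V : Type} (R : Run V)

/-- The record of `v` computed from the displays of its neighbors at time `t`. -/
noncomputable def view (v : V) (t : ℕ) : Rec := mkRec (R.key v) (R.D (R.nl v) t) (R.D (R.nr v) t)

lemma P_cases (v : V) (t : ℕ) :
    R.P v (t + 1) = R.P v t ∨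
    (v ∈ R.S t ∧ R.P v (t + 1) = live (R.view v (t + 1)) ∧ ∀ x, R.P v t ≠ done x) ∨
    (v ∈ R.S t ∧ ∃ r, R.P v t = live r ∧ R.P v (t + 1) = done r.c) := by
  by_cases h : v ∈ R.S t
  · rcases hp : R.P v t with _ | x | r
    · rcases R.P_absent v t h hp with h1 | h1
      · exact .inl h1
      · exact .inr (.inl ⟨h, h1, by simp⟩)
    · exact .inl (R.P_done v t x h hp)
    · have h1 := R.P_live v t r h hp
      split_ifs at h1
      · exact .inr (.inr ⟨h, r, rfl, h1⟩)
      · exact .inr (.inl ⟨h, h1, by simp⟩)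
  · exact .inl (R.P_idle v t h)

lemma D_cases (v : V) (t : ℕ) : R.D v (t + 1) = R.D v t ∨ R.D v (t + 1) = R.P v t := by
  by_cases h : v ∈ R.S t
  · exact .inr (R.D_write v t h)
  · exact .inl (R.D_idle v t h)

/-- The last time before `t` at which `v` computed its state. -/
noncomputable def readTime (v : V) : ℕ → ℕ
  | 0 => 0
  | t + 1 => if v ∈ R.S t then t + 1 else readTime v t

/-- The time at which the display of `v` just before step `t` was pending. -/
noncomputable def writeTime (v : V) : ℕ → ℕ
  | 0 => 0
  | t + 1 => if v ∈ R.S t then t else writeTime v t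

lemma readTime_le (v : V) (t : ℕ) : R.readTime v t ≤ t := by
  induction t with
  | zero => rfl
  | succ t ih => unfold readTime; split_ifs <;> omega

lemma writeTime_le (v : V) (t : ℕ) : R.writeTime v t ≤ t := by
  induction t with
  | zero => rfl
  | succ t ih => unfold writeTime; split_ifs <;> omega

lemma readTime_mono (v : V) : Monotone (R.readTime v) := by
  refine monotone_nat_of_le_succ fun t => ?_
  have := R.readTime_le v t
  rw [readTime]; split_ifs <;> omega

lemma writeTime_mono (v : V) : Monotone (R.writeTime v) := by
  refine monotone_nat_of_le_succ fun t => ?_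
  have := R.writeTime_le v t
  rw [writeTime]; split_ifs <;> omega

lemma P_live_view {v t r} (h : R.P v t = live r) : r = R.view v (R.readTime v t) := by
  induction t generalizing r with
  | zero => simp [R.P_zero] at h
  | succ t ih =>
    unfold readTime
    split_ifs with hv
    · rcases hp : R.P v t with _ | x | r'
      · rcases R.P_absent v t hv hp with h1 | h1 <;> rw [h1] at h
        · simp at h
        · exact (Disp.live.inj h).symm
      · rw [R.P_done v t x hv hp] at h; simp at h
      · rw [R.P_live v t r' hv hp] at h
        split_ifs at h
        exact (Disp.live.inj h).symm
    · exact ih (R.P_idle v t hv ▸ h)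

lemma P_done_mono {v s t x} (hst : s ≤ t) (h : R.P v s = done x) : R.P v t = done x := by
  induction t, hst using Nat.le_induction with
  | base => exact h
  | succ t _ ih =>
    rcases R.P_cases v t with h1 | ⟨-, -, h1⟩ | ⟨-, r', h1, -⟩
    · rw [h1, ih]
    · exact absurd ih (h1 x)
    · simp [h1] at ih

lemma P_ne_absent_mono {v s t} (hst : s ≤ t) (h : R.P v s ≠ absent) : R.P v t ≠ absent := by
  induction t, hst using Nat.le_induction with
  | base => exact h
  | succ t _ ih =>
    rcases R.P_cases v t with h1 | ⟨-, h1, -⟩ | ⟨-, r', -, h1⟩ <;> rw [h1]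
    · exact ih
    · simp
    · simp

lemma D_eq_P (v : V) (t : ℕ) : R.D v t = R.P v (R.writeTime v t) := by
  induction t with
  | zero => exact (R.D_zero v).trans (R.P_zero v).symm
  | succ t ih =>
    unfold writeTime
    split_ifs with h
    · exact R.D_write v t h
    · exact (R.D_idle v t h).trans ih

lemma D_done_mono {v s t x} (hst : s ≤ t) (h : R.D v s = done x) : R.D v t = done x := by
  have hs' := R.writeTime_le v s
  have h' := R.D_eq_P v s
  induction t, hst using Nat.le_induction with
  | base => exact h
  | succ t ht ih =>
    rcases R.D_cases v t with h1 | h1 <;> rw [h1]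
    · exact ih
    · exact R.P_done_mono (hs'.trans ht) (h' ▸ h)

lemma D_ne_absent_mono {v s t} (hst : s ≤ t) (h : R.D v s ≠ absent) : R.D v t ≠ absent := by
  have hs' := R.writeTime_le v s
  have h' := R.D_eq_P v s
  induction t, hst using Nat.le_induction with
  | base => exact h
  | succ t ht ih =>
    rcases R.D_cases v t with h1 | h1 <;> rw [h1]
    · exact ih
    · exact R.P_ne_absent_mono (hs'.trans ht) (h' ▸ h)

/-- The time at which the display of `v` just before step `t` was computed. -/
noncomputable def viewTime (v : V) (t : ℕ) : ℕ := R.readTime v (R.writeTime v t)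

lemma viewTime_le (v : V) (t : ℕ) : R.viewTime v t ≤ t :=
  (R.readTime_le _ _).trans (R.writeTime_le _ _)

lemma viewTime_mono (v : V) : Monotone (R.viewTime v) :=
  (R.readTime_mono v).comp (R.writeTime_mono v)

lemma D_live_view {v t r} (h : R.D v t = live r) : r = R.view v (R.viewTime v t) :=
  R.P_live_view ((R.D_eq_P v t).symm.trans h)

lemma D_live_key {v t r} (h : R.D v t = live r) : r.key = R.key v := by
  rw [R.D_live_view h]; rfl

/-- A live display of a neighbor was computed from an earlier display of the node itself. -/
lemma nbr_view {u v t r} (huv : u = R.nl v ∨ u = R.nr v) (h : R.D u t = live r) :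
    ∃ w, r = mkRec (R.key u) (R.D v (R.viewTime u t)) (R.D w (R.viewTime u t)) := by
  have h' := R.D_live_view h
  rcases R.symm u v huv with h1 | h1
  · exact ⟨_, by rw [h', view, ← h1]⟩
  · exact ⟨_, by rw [h', view, ← h1, mkRec_comm]⟩

/-- A neighbor that is live at time `t` was absent or live with the same key before. -/
lemma D_before_live {u s t r} (hst : s ≤ t) (h : R.D u t = live r) :
    R.D u s = absent ∨ ∃ r', R.D u s = live r' ∧ r'.key = r.key := by
  rcases hu : R.D u s with _ | x | r'
  · exact .inl rfl
  · rw [R.D_done_mono hst hu] at h; simp at h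
  · exact .inr ⟨r', rfl, by rw [R.D_live_key hu, R.D_live_key h]⟩

lemma isSmall_before {k u s t r} (hst : s ≤ t) (h : R.D u t = live r)
    (h' : IsSmall k (R.D u s)) : IsSmall k (R.D u t) := by
  rcases R.D_before_live hst h with h1 | ⟨r', h1, h2⟩
  · simp [h1, IsSmall] at h'
  · simpa [h1, h, IsSmall, h2] using h'

lemma isLarge_before {k u s t r} (hst : s ≤ t) (h : R.D u t = live r)
    (h' : IsLarge k (R.D u s)) : IsLarge k (R.D u t) := by
  rcases R.D_before_live hst h with h1 | ⟨r', h1, h2⟩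
  · simp [h1, IsLarge] at h'
  · simpa [h1, h, IsLarge, h2] using h'

/-- A node terminates only with the color that it wrote in the same step, so its register shows that
color even before the terminated state is written. -/
lemma P_done_color {v t x} (h : R.P v t = done x) : (R.D v t).color = some x := by
  induction t with
  | zero => simp [R.P_zero] at h
  | succ t ih =>
    by_cases hS : v ∈ R.S t
    · rw [R.D_write v t hS]
      rcases hp : R.P v t with _ | y | r
      · rcases R.P_absent v t hS hp with h1 | h1 <;> simp [h1] at h
      · rw [R.P_done v t y hS hp] at h
        simpa [color] using h
      · have h1 := R.P_live v t r hS hp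
        rw [h] at h1
        split_ifs at h1
        simpa [color] using h1.symm
    · rw [R.D_idle v t hS]
      exact ih (R.P_idle v t hS ▸ h)

/-- Terminated neighbors have different colors. -/
lemma done_ne {u v t x y} (huv : u = R.nl v ∨ u = R.nr v) (hu : R.P u t = done x)
    (hv : R.P v t = done y) : x ≠ y := by
  -- If `v` terminates in step `t`, it has compared its color with the display of `u`, which shows
  -- the output of `u` even if `u` terminates in the same step.
  have fresh : ∀ {u v t x y}, (u = R.nl v ∨ u = R.nr v) → R.P u (t + 1) = done x →
      R.P v (t + 1) = done y → (∃ r, v ∈ R.S t ∧ R.P v t = live r ∧ R.P v (t + 1) = done r.c) →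
      x ≠ y := by
    rintro u v t x y huv hu hv ⟨r, hS, hp, h1⟩
    have h2 := R.P_live v t r hS hp
    rw [h1] at h2
    split_ifs at h2 with h3
    have h4 := R.P_done_color hu
    have h5 : y = r.c := Disp.done.inj (hv.symm.trans h1)
    subst h5
    rintro rfl
    rcases huv with rfl | rfl
    · exact h3.1 h4
    · exact h3.2 h4
  induction t with
  | zero => simp [R.P_zero] at hu
  | succ t ih =>
    rcases R.P_cases v t with h | ⟨-, h, -⟩ | ⟨hS, r, h, h'⟩
    · rcases R.P_cases u t with k | ⟨-, k, -⟩ | ⟨hS, r, k, k'⟩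
      · exact ih (k ▸ hu) (h ▸ hv)
      · simp [k] at hu
      · exact (fresh (R.symm u v huv) hv hu ⟨r, hS, k, k'⟩).symm
    · simp [h] at hv
    · exact fresh huv hu hv ⟨r, hS, h, h'⟩

end Run
end FiveColoring
end AsyncLocal

/-! ### Constraints between the records of neighbors. -/

namespace AsyncLocal
namespace FiveColoring
open Disp
open scoped Classical
namespace Run
variable {V : Type} (R : Run V)

/-- `u` and `w` are the two neighbors of `v`. -/
def Nbrs (v u w : V) : Prop := (u = R.nl v ∧ w = R.nr v) ∨ (u = R.nr v ∧ w = R.nl v)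

variable {R}

lemma Nbrs.swap {v u w : V} (h : R.Nbrs v u w) : R.Nbrs v w u := by
  rcases h with ⟨h, h'⟩ | ⟨h, h'⟩
  · exact .inr ⟨h', h⟩
  · exact .inl ⟨h', h⟩

lemma Nbrs.mem {v u w : V} (h : R.Nbrs v u w) : u = R.nl v ∨ u = R.nr v := by
  rcases h with ⟨h, -⟩ | ⟨h, -⟩
  · exact .inl h
  · exact .inr h

lemma Nbrs.view {v u w : V} (h : R.Nbrs v u w) (t : ℕ) :
    R.view v t = mkRec (R.key v) (R.D u t) (R.D w t) := by
  rcases h with ⟨h, h'⟩ | ⟨h, h'⟩ <;> subst h h'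
  · rfl
  · rw [mkRec_comm]; rfl

lemma left_mem (u : V) (t : ℕ) :
    (R.D u t).left = 0 ∨ (R.D u t).left = 1 ∨ (R.D u t).left = 4 := by
  rcases h : R.D u t with _ | x | r
  · simp [left]
  · simp [left]
  · simp only [left]
    rw [R.D_live_view h]
    exact gVal_mem ..

lemma a_mem {u : V} {t : ℕ} {r} (h : R.D u t = live r) : r.a = 0 ∨ r.a = 1 := by
  rw [R.D_live_view h]
  exact aVal_le ..

lemma b_mem {u : V} {t : ℕ} {r} (h : R.D u t = live r) : r.b = 0 ∨ r.b = 1 ∨ r.b = 2 := by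
  rw [R.D_live_view h]
  exact bVal_le ..

lemma c_of_b_one {u : V} {t : ℕ} {r} (h : R.D u t = live r) (hb : r.b = 1) :
    r.c = if r.a = 0 then 2 else 3 := by
  have h1 := R.D_live_view h
  subst h1
  exact cVal_of_bVal_one hb

lemma c_of_b_ne_one {u : V} {t : ℕ} {r} (h : R.D u t = live r) (hb : r.b ≠ 1) :
    r.c = 0 ∨ r.c = 1 ∨ r.c = 4 := by
  have hb' := b_mem h
  have h1 := R.D_live_view h
  generalize R.viewTime u t = s at h1
  subst h1
  rcases hb' with h1 | h1 | h1
  · exact cVal_mem h1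
  · exact absurd h1 hb
  · change bVal _ _ _ = 2 at h1
    change cVal _ _ _ = 0 ∨ cVal _ _ _ = 1 ∨ cVal _ _ _ = 4
    rcases bVal_eq_two h1 with h2 | h2
    · have : ¬ (IsSmall (R.key u) (R.D (R.nl u) s) ∧ IsSmall (R.key u) (R.D (R.nr u) s)) :=
        fun h3 => h2.1.isLarge.not_isSmall h3.1
      rw [cVal, if_neg this, if_pos h1, if_pos h2.1]
      exact left_mem _ _
    · have : ¬ (IsSmall (R.key u) (R.D (R.nl u) s) ∧ IsSmall (R.key u) (R.D (R.nr u) s)) :=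
        fun h3 => h2.1.isLarge.not_isSmall h3.2
      have h4 : ¬ LargeB (R.key u) 0 (R.D (R.nl u) s) :=
        fun h5 => absurd (h5.unique h2.2) (by norm_num)
      rw [cVal, if_neg this, if_pos h1, if_neg h4]
      exact left_mem _ _

/-- For b = 2 both neighbors must look larger, while a = 1 needs a smaller one. -/
lemma a_of_b_two {u : V} {t : ℕ} {r} (h : R.D u t = live r) (hb : r.b = 2) : r.a = 0 := by
  have h1 := R.D_live_view h
  generalize R.viewTime u t = s at h1
  subst h1
  rcases aVal_le (R.key u) (R.D (R.nl u) s) (R.D (R.nr u) s) with h1 | h1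
  · exact h1
  · rcases (aVal_eq_one h1).2 with h2 | h2 <;> rcases bVal_eq_two hb with h3 | h3
    · exact absurd h2.isSmall h3.1.isLarge.not_isSmall
    · exact absurd h2.isSmall h3.2.isLarge.not_isSmall
    · exact absurd h2.isSmall h3.2.isLarge.not_isSmall
    · exact absurd h2.isSmall h3.1.isLarge.not_isSmall

lemma c_ne_g {u : V} {t : ℕ} {r} (h : R.D u t = live r) (hb : r.b = 0) : r.c ≠ r.g := by
  have h1 := R.D_live_view h
  subst h1
  exact cVal_ne_gVal hb

section Node

variable {v u w : V} {t : ℕ} {r : Rec}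

/-- A node that has not terminated does not look small to a smaller neighbor. -/
lemma small_nbr_view (hv : ∀ x, R.D v t ≠ done x) (huv : R.Nbrs v u w) (h : R.D u t = live r)
    (hk : R.key u < R.key v) :
    ∃ w', r = mkRec (R.key u) (R.D v (R.viewTime u t)) (R.D w' (R.viewTime u t)) ∧
      ¬ IsSmall (R.key u) (R.D v (R.viewTime u t)) := by
  obtain ⟨w', hw⟩ := R.nbr_view huv.mem h
  refine ⟨w', hw, ?_⟩
  rcases h1 : R.D v (R.viewTime u t) with _ | x | q
  · simp [IsSmall]
  · exact absurd (R.D_done_mono (R.viewTime_le u t) h1) (hv x)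
  · simp only [IsSmall, R.D_live_key h1]; omega

/-- The node `v` did not look small to `u`, so `u` did not use `pick`, and its color follows its
pair. -/
lemma small_c_of_b_zero (hv : ∀ x, R.D v t ≠ done x) (huv : R.Nbrs v u w)
    (h : R.D u t = live r) (hk : R.key u < R.key v) (hb : r.b = 0) :
    (r.a = 0 → r.c = 0) ∧ (r.a = 1 → r.c = 1 ∨ r.c = 4) := by
  obtain ⟨w', rfl, h1⟩ := small_nbr_view hv huv h hk
  have h2 := cVal_of_bVal_zero (fun h' => h1 h'.1) hb
  constructor <;> intro ha
  · change aVal _ _ _ = 0 at ha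
    simp only [mkRec]; rw [h2, if_pos ha]
  · change aVal _ _ _ = 1 at ha
    simp only [mkRec]; rw [h2, if_neg (by omega)]
    split_ifs <;> simp

lemma large_b_ne_two (huv : R.Nbrs v u w) (h : R.D u t = live r)
    (hk : R.key v < R.key u) : r.b ≠ 2 := by
  obtain ⟨w', rfl⟩ := R.nbr_view huv.mem h
  intro hb
  have h1 : IsLarge (R.key u) (R.D v (R.viewTime u t)) := by
    rcases bVal_eq_two hb with h2 | h2
    · exact h2.1.isLarge
    · exact h2.2.isLarge
  rcases h2 : R.D v (R.viewTime u t) with _ | x | q <;> rw [h2] at h1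
  · exact h1
  · exact h1
  · simp only [IsLarge, R.D_live_key h2] at h1; omega

/-- If `v` shows at time `s` that it leaves color `1`, then both its neighbors were small. -/
lemma g_eq_one {s : ℕ} {q : Rec} (huv : R.Nbrs v u w) (h : R.D v s = live q) (hg : q.g = 1) :
    IsSmall (R.key v) (R.D u (R.viewTime v s)) ∧ IsSmall (R.key v) (R.D w (R.viewTime v s)) ∧
      (LowOne (R.D u (R.viewTime v s)) ∨ LowOne (R.D w (R.viewTime v s))) := by
  have h1 := (R.D_live_view h).trans (huv.view _)
  subst h1
  have h2 := gVal_eq_one hg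
  exact ⟨h2.1.1, h2.1.2, h2.2⟩

/-- The color of a display with `b = 2`. -/
lemma c_of_b_two {k : ℕ} {d e : Disp} (h : bVal k d e = 2) (hd : LargeB k 0 d) :
    cVal k d e = d.left := by
  rw [cVal, if_neg fun h3 => hd.isLarge.not_isSmall h3.1, if_pos h, if_pos hd]

/-- A smaller neighbor cannot show color `1` with `b = 2` while the other one is absent. -/
lemma not_one_of_absent (hv : ∀ x, R.D v t ≠ done x) (huv : R.Nbrs v u w)
    (h : R.D u t = live r) (hk : R.key u < R.key v) (hw : R.D w t = absent)
    (hb : r.b = 2) : r.c ≠ 1 := by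
  obtain ⟨w', hr, -⟩ := small_nbr_view hv huv h hk
  have hs := R.viewTime_le u t
  generalize R.viewTime u t = s at hr hs
  have habs : ∀ s' ≤ t, R.D w s' = absent := fun s' hs' => by
    by_contra hc; exact R.D_ne_absent_mono hs' hc hw
  intro hc
  subst hr
  change bVal _ _ _ = 2 at hb
  change cVal _ _ _ = 1 at hc
  -- Either `v` itself left color 1, for which it must have seen two smaller neighbors although `w`
  -- was absent; or `v` showed b = 1, although it had no larger neighbor.
  rcases bVal_eq_two hb with h2 | h2
  · rw [c_of_b_two hb h2.1] at hc
    rcases h3 : R.D v s with _ | x | q <;> rw [h3] at h2 hc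
    · exact h2.1
    · exact h2.1
    · have h4 := (g_eq_one huv h3 hc).2.1
      rw [habs _ ((R.viewTime_le v s).trans hs)] at h4
      exact h4
  · rcases h3 : R.D v s with _ | x | q <;> rw [h3] at h2
    · exact h2.2
    · exact h2.2
    · have h4 := (R.D_live_view h3).trans (huv.view _)
      have hs' := (R.viewTime_le v s).trans hs
      generalize R.viewTime v s = s' at h4 hs'
      have h5 : q.b = 0 := by
        subst h4
        refine bVal_of_not_large (fun h6 => ?_) (by rw [habs _ hs']; exact id)
        have h7 := R.isLarge_before hs' h h6
        simp only [h, IsLarge, mkRec] at h7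
        omega
      have := h2.2.2
      omega

end Node
end Run
end FiveColoring
end AsyncLocal

/-! ### A node with two smaller neighbors. -/

namespace AsyncLocal
namespace FiveColoring
open Disp
open scoped Classical
namespace Run
variable {V : Type} {R : Run V}

section Node

variable {v u w : V} {t : ℕ} {r q : Rec}

/-- Keys never change, so a neighbor that is live and smaller now never looked larger before. -/
lemma b_eq_zero_of_small (huv : R.Nbrs v u w) (hu : R.D u t = live r) (hw : R.D w t = live q)
    (hru : r.key < R.key v) (hqw : q.key < R.key v) {s : ℕ} (hs : s ≤ t) {p : Rec}
    (h : R.D v s = live p) : p.b = 0 := by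
  have h1 := (R.D_live_view h).trans (huv.view _)
  have hs' := (R.viewTime_le v s).trans hs
  generalize R.viewTime v s = s' at h1 hs'
  subst h1
  refine bVal_of_not_large (fun h6 => ?_) (fun h6 => ?_)
  · have h7 := R.isLarge_before hs' hu h6
    simp only [hu, IsLarge] at h7
    omega
  · have h7 := R.isLarge_before hs' hw h6
    simp only [hw, IsLarge] at h7
    omega

/-- Color 4 would require that `u` saw color 1 at a smaller neighbor, which is not `v`, and also saw
a larger neighbor, which must then be `v`. But `v` always shows b = 0, and this would force b ≠ 0 at
`u`. -/
lemma c_eq_one_of_small (hv : ∀ x, R.D v t ≠ done x) (huv : R.Nbrs v u w)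
    (hu : R.D u t = live r) (hw : R.D w t = live q)
    (hru : r.key < R.key v) (hqw : q.key < R.key v) (hb : r.b = 0) (ha : r.a = 1) :
    r.c = 1 := by
  obtain ⟨w', hr, h1⟩ := small_nbr_view hv huv hu (by rwa [← R.D_live_key hu])
  have hs := R.viewTime_le u t
  generalize R.viewTime u t = s at hr hs h1
  have hb0 : ∀ p, R.D v s = live p → p.b = 0 := fun p hp =>
    b_eq_zero_of_small huv hu hw hru hqw hs hp
  subst hr
  change bVal _ _ _ = 0 at hb
  change aVal _ _ _ = 1 at ha
  change cVal _ _ _ = 1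
  rw [cVal_of_bVal_zero (fun h' => h1 h'.1) hb, if_neg (by omega), if_neg]
  rintro ⟨hl, hs'⟩
  have h2 : IsSmall (R.key u) (R.D w' s) := by
    rcases hs' with h | h
    · exact absurd h.1 h1
    · exact h.1
  have h3 : IsLarge (R.key u) (R.D v s) := by
    rcases hl with h | h
    · exact h
    · exact absurd h2 h.not_isSmall
  have h4 : LargeB (R.key u) 0 (R.D v s) := by
    rcases h5 : R.D v s with _ | x | p <;> rw [h5] at h3
    · exact h3
    · exact h3
    · exact ⟨h3, hb0 p h5⟩
  unfold bVal at hb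
  rw [if_pos (.inl h4)] at hb
  split_ifs at hb

/-- A live display that has `b = 2` later has `a = 0`. -/
lemma a_eq_zero_of_later_b_two {s : ℕ} {p : Rec} (hs : s ≤ t) (h : R.D u s = live p)
    (h' : R.D u t = live r) (hb : r.b = 2) : p.a = 0 := by
  have h1 := R.D_live_view h
  have h1' := R.D_live_view h'
  have hst := R.viewTime_mono u hs
  generalize R.viewTime u s = s1 at h1 hst
  generalize R.viewTime u t = t1 at h1' hst
  subst h1 h1'
  rcases aVal_le (R.key u) (R.D (R.nl u) s1) (R.D (R.nr u) s1) with h1 | h1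
  · exact h1
  · exfalso
    have hl : ∀ x, x = R.nl u ∨ x = R.nr u → IsLarge (R.key u) (R.D x t1) := by
      rintro x (rfl | rfl) <;> rcases bVal_eq_two hb with h2 | h2
      · exact h2.1.isLarge
      · exact h2.2.isLarge
      · exact h2.2.isLarge
      · exact h2.1.isLarge
    have key : ∀ x, x = R.nl u ∨ x = R.nr u → ¬ IsSmall (R.key u) (R.D x s1) := by
      intro x hx hsm
      have h2 := hl x hx
      rcases h3 : R.D x t1 with _ | y | z
      · rw [h3] at h2; exact h2
      · rw [h3] at h2; exact h2
      · exact h2.not_isSmall (R.isSmall_before hst h3 hsm)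
    rcases (aVal_eq_one h1).2 with h2 | h2
    · exact key _ (.inl rfl) h2.isSmall
    · exact key _ (.inr rfl) h2.isSmall

/-- If both neighbors are smaller and show `b = 2`, then none of them shows color `1`. -/
lemma c_ne_one_of_b_two (hv : ∀ x, R.D v t ≠ done x) (huv : R.Nbrs v u w)
    (hu : R.D u t = live r) (hw : R.D w t = live q)
    (hru : r.key < R.key v) (hqw : q.key < R.key v) (hb : r.b = 2) (hb' : q.b = 2) :
    r.c ≠ 1 := by
  obtain ⟨w', hr, h1⟩ := small_nbr_view hv huv hu (by rwa [← R.D_live_key hu])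
  have hs := R.viewTime_le u t
  generalize R.viewTime u t = s at hr hs h1
  have hb0 : ∀ p, R.D v s = live p → p.b = 0 := fun p hp =>
    b_eq_zero_of_small huv hu hw hru hqw hs hp
  have hrb := hb
  subst hr
  change bVal _ _ _ = 2 at hb
  intro hc
  change cVal _ _ _ = 1 at hc
  have h2 : LargeB (R.key u) 0 (R.D v s) := by
    rcases bVal_eq_two hb with h2 | h2
    · exact h2.1
    · have h3 := h2.2
      rcases h4 : R.D v s with _ | x | p <;> rw [h4] at h3
      · exact h3.elim
      · exact h3.elim
      · have h5 := h3.2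
        rw [hb0 p h4] at h5
        simp at h5
  rw [c_of_b_two hb h2] at hc
  rcases h4 : R.D v s with _ | x | p <;> rw [h4] at h2 hc
  · exact h2
  · exact h2
  · have h5 := g_eq_one huv h4 hc
    have hs' := (R.viewTime_le v s).trans hs
    generalize R.viewTime v s = s1 at h5 hs'
    -- Color 1 was left by `v`, which does so only if a neighbor satisfies `LowOne`. A neighbor that
    -- is live with b = 2 now had a = 0 whenever it was live before.
    have key : ∀ x z, R.D x t = live z → z.b = 2 → ¬ LowOne (R.D x s1) := by
      intro x z hx hz hl
      rcases R.D_before_live hs' hx with h6 | ⟨z', h6, -⟩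
      · rw [h6] at hl; exact hl
      · rw [h6] at hl
        have := a_eq_zero_of_later_b_two hs' h6 hx hz
        have := hl.2
        omega
    rcases h5.2.2 with h6 | h6
    · exact key u _ hu hrb h6
    · exact key w _ hw hb' h6

/-- A node with two smaller neighbors finds a color. -/
lemma color_ne_of_small (hv : ∀ x, R.D v t ≠ done x) (huv : R.Nbrs v u w)
    (hu : IsSmall (R.key v) (R.D u t)) (hw : IsSmall (R.key v) (R.D w t)) :
    (R.D u t).color ≠ some (cVal (R.key v) (R.D u t) (R.D w t)) := by
  have hss : IsSmall (R.key v) (R.D u t) ∧ IsSmall (R.key v) (R.D w t) := ⟨hu, hw⟩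
  have hcv : cVal (R.key v) (R.D u t) (R.D w t) =
      pick (gVal (R.key v) (R.D u t) (R.D w t)) (R.D u t).color (R.D w t).color := by
    rw [cVal, if_pos hss]
  intro hc
  rw [hcv] at hc
  -- A conflict means that the neighbors show both colors of {0, 1, 4} other than g. Each case in
  -- the choice of g rules this out; for g = 4 the neighbors would be live with b = 2 and show 0 and
  -- 1.
  have hbad := pick_bad (gVal_mem _ _ _) (.inl hc)
  have hg : gVal (R.key v) (R.D u t) (R.D w t) =
      if IsDoneZero (R.D u t) ∨ IsDoneZero (R.D w t) then 0
      else if LowOne (R.D u t) ∨ LowOne (R.D w t) then 1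
      else if LowZero (R.D u t) ∨ LowZero (R.D w t) then 0 else 4 := by
    rw [gVal, if_pos hss]
  have z0 := hbad 0 (by simp)
  have z1 := hbad 1 (by simp)
  have z4 := hbad 4 (by simp)
  rw [hg] at z0 z1 z4
  clear hbad hg hc hcv hss
  have zz : ∀ x y : V, R.Nbrs v x y → ∀ p, R.D x t = live p → p.key < R.key v →
      (p.b = 0 ∧ p.a = 0 ∧ p.c = 0) ∨ (p.b = 0 ∧ p.a = 1 ∧ (p.c = 1 ∨ p.c = 4)) ∨
      (p.b = 1 ∧ (p.c = 2 ∨ p.c = 3)) ∨ p.b = 2 := by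
    intro x y hxy p hp hpk
    have h1 := small_c_of_b_zero hv hxy hp (by rwa [← R.D_live_key hp])
    rcases b_mem hp with h2 | h2 | h2
    · rcases a_mem hp with h3 | h3
      · exact .inl ⟨h2, h3, (h1 h2).1 h3⟩
      · exact .inr (.inl ⟨h2, h3, (h1 h2).2 h3⟩)
    · refine .inr (.inr (.inl ⟨h2, ?_⟩))
      rw [c_of_b_one hp h2]
      split_ifs <;> simp
    · exact .inr (.inr (.inr h2))
  rcases hdu : R.D u t with _ | x | r
  · rw [hdu] at hu; exact hu
  · rcases hdw : R.D w t with _ | y | q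
    · rw [hdw] at hw; exact hw
    · rw [hdu, hdw] at z0 z1 z4
      simp only [IsDoneZero, LowOne, LowZero, color, Option.some.injEq, or_self, if_false] at z0 z1 z4
      clear zz hdu hdw hu hw
      revert x y
      decide
    · rw [hdw] at hw
      have h1 := zz w u huv.swap q hdw hw
      rw [hdu, hdw] at z0 z1 z4
      simp only [IsDoneZero, LowOne, LowZero, color, Option.some.injEq, or_false, false_or]
        at z0 z1 z4
      rcases h1 with ⟨hb, ha, hc⟩ | ⟨hb, ha, hc | hc⟩ | ⟨hb, hc | hc⟩ | hb <;>
        split_ifs at z0 z1 z4 <;> simp_all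
  · rcases hdw : R.D w t with _ | y | q
    · rw [hdw] at hw; exact hw
    · rw [hdu] at hu
      have h1 := zz u w huv r hdu hu
      rw [hdu, hdw] at z0 z1 z4
      simp only [IsDoneZero, LowOne, LowZero, color, Option.some.injEq, or_false, false_or]
        at z0 z1 z4
      rcases h1 with ⟨hb, ha, hc⟩ | ⟨hb, ha, hc | hc⟩ | ⟨hb, hc | hc⟩ | hb <;>
        split_ifs at z0 z1 z4 <;> simp_all
    · rw [hdu] at hu
      rw [hdw] at hw
      have h1 := zz u w huv r hdu hu
      have h2 := zz w u huv.swap q hdw hw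
      have h3 := c_eq_one_of_small hv huv hdu hdw hu hw
      have h4 := c_eq_one_of_small hv huv.swap hdw hdu hw hu
      have h5 := c_ne_one_of_b_two hv huv hdu hdw hu hw
      have h6 := c_ne_one_of_b_two hv huv.swap hdw hdu hw hu
      rw [hdu, hdw] at z0 z1 z4
      simp only [IsDoneZero, LowOne, LowZero, color, Option.some.injEq, or_self, if_false]
        at z0 z1 z4
      clear zz hu hw hdu hdw hv huv
      rcases h1 with ⟨hb, ha, hc⟩ | ⟨hb, ha, hc | hc⟩ | ⟨hb, hc | hc⟩ | hb <;>
      rcases h2 with ⟨hb', ha', hc'⟩ | ⟨hb', ha', hc' | hc'⟩ | ⟨hb', hc' | hc'⟩ | hb' <;>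
        simp_all

end Node
end Run
end FiveColoring
end AsyncLocal

/-! ### A freshly computed color is shown by no neighbor. -/

namespace AsyncLocal
namespace FiveColoring
open Disp
open scoped Classical
namespace Run
variable {V : Type} {R : Run V}

section Node

variable {v u w : V} {t : ℕ} {r q : Rec}

lemma aVal_of_not_small {k : ℕ} {d e : Disp} (h : ¬ IsSmall k e) :
    aVal k d e = if ZeroA k d then 1 else 0 := by
  have h1 : ¬ ZeroA k e := fun h' => h h'.isSmall
  simp [aVal, h, h1]

lemma cVal_of_bVal_two {k : ℕ} {d e : Disp} (h : bVal k d e = 2) :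
    (LargeB k 0 d ∧ cVal k d e = d.left) ∨ (LargeB k 0 e ∧ cVal k d e = e.left) := by
  rcases bVal_eq_two h with h1 | h1
  · exact .inl ⟨h1.1, c_of_b_two h h1.1⟩
  · exact .inr ⟨h1.1, by rw [cVal_comm]; exact c_of_b_two (by rwa [bVal_comm]) h1.1⟩

/-- Here b ≠ 2. If x is 0 or 2, then a = 1 and the new color is 1, 3 or 4; otherwise a = 0 and it is
0 or 2. -/
lemma color_ne_of_done {k : ℕ} {x : Fin 5} {e : Disp} (he : ¬ IsSmall k e) :
    x ≠ cVal k (done x) e := by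
  have ha := aVal_of_not_small (d := done x) he
  have hss : ¬ (IsSmall k (done x) ∧ IsSmall k e) := fun h => he h.2
  simp only [ZeroA] at ha
  rcases bVal_le k (done x) e with hb | hb | hb
  · rw [cVal_of_bVal_zero hss hb, ha]
    by_cases h1 : x = 0 ∨ x = 2
    · simp only [h1, if_true, one_ne_zero, if_false]
      split_ifs <;> rcases h1 with rfl | rfl <;> decide
    · simp only [h1, if_false, if_true]
      exact fun h => h1 (.inl h)
  · rw [cVal_of_bVal_one hb, ha]
    by_cases h1 : x = 0 ∨ x = 2
    · simp only [h1, if_true, one_ne_zero, if_false]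
      rcases h1 with rfl | rfl <;> decide
    · simp only [h1, if_false, if_true]
      exact fun h => h1 (.inr h)
  · rcases bVal_eq_two hb with h1 | h1
    · exact h1.1.elim
    · exact h1.2.elim

/-- A smaller neighbor excludes b = 2 at `v`. If exactly one of `u` and `v` has b = 1, the palettes
{2, 3} and {0, 1, 4} separate them; otherwise their values of a differ. -/
lemma color_ne_of_live_small (hv : ∀ x, R.D v t ≠ done x) (huv : R.Nbrs v u w)
    (hu : R.D u t = live r) (hk : R.key u < R.key v) (hw : ¬ IsSmall (R.key v) (R.D w t))
    (hw' : ∀ q, R.D w t = live q → R.key w ≠ R.key v) :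
    r.c ≠ cVal (R.key v) (live r) (R.D w t) := by
  have hrk := R.D_live_key hu
  have ha := aVal_of_not_small (d := live r) hw
  have hss : ¬ (IsSmall (R.key v) (live r) ∧ IsSmall (R.key v) (R.D w t)) := fun h => hw h.2
  simp only [ZeroA, hrk, hk, true_and] at ha
  rcases bVal_le (R.key v) (live r) (R.D w t) with hb | hb | hb
  · by_cases hrb : r.b = 1
    · have h1 := c_of_b_one hu hrb
      rw [h1]
      intro h2
      rcases cVal_mem hb with h3 | h3 | h3 <;> rw [h3] at h2 <;> split_ifs at h2 <;> simp_all
    · have hz := small_c_of_b_zero hv huv hu hk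
      rw [cVal_of_bVal_zero hss hb, ha]
      have hb' := b_mem hu
      by_cases hra : r.a = 0
      · simp only [hra, if_true, one_ne_zero, if_false]
        -- Now `v` has the pair (1, 0). The smaller neighbor shows 1 only with b = 2, and then `w`
        -- cannot be absent, so it is larger and the escape color 4 applies.
        by_cases h1 : r.c = 1
        · have hb2 : r.b = 2 := by
            rcases hb' with h2 | h2 | h2
            · have := (hz h2).1 hra
              simp [h1] at this
            · exact absurd h2 hrb
            · exact h2
          have hl : IsLarge (R.key v) (R.D w t) := by
            rcases h3 : R.D w t with _ | x | q
            · exact absurd h1 (not_one_of_absent hv huv hu hk h3 hb2)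
            · rw [h3] at hw; exact absurd trivial hw
            · rw [h3] at hw
              have := hw' q h3
              simp only [IsSmall, IsLarge, R.D_live_key h3] at hw ⊢
              omega
          rw [if_pos ⟨.inr hl, .inl ⟨by simp only [IsSmall]; omega, by simp [color, h1]⟩⟩, h1]
          decide
        · split_ifs with h2
          · rcases h2.2 with h3 | h3
            · simp [color, h1] at h3
            · exact absurd h3.1 hw
          · exact h1
      · simp only [hra, if_false, if_true]
        rcases hb' with h2 | h2 | h2
        · rcases a_mem hu with h3 | h3
          · exact absurd h3 hra
          · rcases (hz h2).2 h3 with h4 | h4 <;> rw [h4] <;> decide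
        · exact absurd h2 hrb
        · exact absurd (a_of_b_two hu h2) hra
  · rw [cVal_of_bVal_one hb, ha]
    by_cases hrb : r.b = 1
    · have h1 := c_of_b_one hu hrb
      rw [h1]
      rcases a_mem hu with h2 | h2 <;> simp [h2]
    · rcases c_of_b_ne_one hu hrb with h1 | h1 | h1 <;> rw [h1] <;> split_ifs <;> simp_all
  · have hu' : ¬ IsLarge (R.key v) (live r) := by simp only [IsLarge]; omega
    rcases bVal_eq_two hb with h1 | h1
    · exact absurd h1.1.isLarge hu'
    · exact absurd h1.2.isLarge hu'

/-- If `u` has b = 0, then `v` takes 2 or 3, or, with b = 2, the color g of `u`, which `u` avoids.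
If `u` has b = 1, then `v` has b ≠ 1 and avoids 2 and 3. -/
lemma color_ne_of_live_large (huv : R.Nbrs v u w)
    (hu : R.D u t = live r) (hk : R.key v < R.key u) :
    r.c ≠ cVal (R.key v) (live r) (R.D w t) := by
  have hrk := R.D_live_key hu
  have h0 : r.b = 0 → LargeB (R.key v) 0 (live r) := fun h => ⟨by omega, h⟩
  have h1 : r.b = 1 → LargeB (R.key v) 1 (live r) := fun h => ⟨by omega, h⟩
  rcases b_mem hu with hrb | hrb | hrb
  · rcases bVal_le (R.key v) (live r) (R.D w t) with hb | hb | hb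
    · unfold bVal at hb
      rw [if_pos (.inl (h0 hrb))] at hb
      split_ifs at hb
    · rw [cVal_of_bVal_one hb]
      rcases c_of_b_ne_one hu (by omega) with h1 | h1 | h1 <;> rw [h1] <;> split_ifs <;> simp_all
    · rw [c_of_b_two hb (h0 hrb)]
      exact c_ne_g hu hrb
  · have hc := c_of_b_one hu hrb
    have hc' : r.c = 2 ∨ r.c = 3 := by rw [hc]; split_ifs <;> simp
    rcases bVal_le (R.key v) (live r) (R.D w t) with hb | hb | hb
    · rcases cVal_mem hb with h3 | h3 | h3 <;> rw [h3] <;> rintro h4 <;> simp [h4] at hc'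
    · unfold bVal at hb
      rw [if_pos (c := LargeB _ 1 _ ∨ _) (.inl (h1 hrb))] at hb
      split_ifs at hb; simp at hb
    · rcases cVal_of_bVal_two hb with h2 | h2
      · have := h2.1.2
        omega
      · rw [h2.2]
        rcases left_mem (R := R) w t with h3 | h3 | h3 <;> rw [h3] <;> rintro h4 <;>
          simp [h4] at hc'
  · exact absurd hrb (large_b_ne_two huv hu hk)

/-- The color that a node computes from the current displays of its neighbors is shown by none
of them. -/
lemma color_ne (hl : R.D v t = live q) (huv : R.Nbrs v u w) :
    (R.D u t).color ≠ some (cVal (R.key v) (R.D u t) (R.D w t)) := by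
  have hv : ∀ x, R.D v t ≠ done x := by simp [hl]
  rcases h : R.D u t with _ | x | r
  · simp [color]
  · by_cases hw : IsSmall (R.key v) (R.D w t)
    · rw [← h]
      exact color_ne_of_small hv huv (by rw [h]; trivial) hw
    · simpa [color] using color_ne_of_done hw
  · have hk := R.key_ne u v t _ _ huv.mem h hl
    rcases lt_or_gt_of_ne hk with hk | hk
    · by_cases hw : IsSmall (R.key v) (R.D w t)
      · rw [← h]
        refine color_ne_of_small hv huv ?_ hw
        rw [h]
        simpa only [IsSmall, R.D_live_key h] using hk
      · simpa [color] using color_ne_of_live_small hv huv h hk hw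
          fun q hq => R.key_ne w v t _ _ huv.swap.mem hq hl
    · simpa [color] using color_ne_of_live_large huv h hk

lemma view_color_ne (hl : R.D v t = live q) :
    (R.D (R.nl v) t).color ≠ some (R.view v t).c ∧
      (R.D (R.nr v) t).color ≠ some (R.view v t).c := by
  have h : R.Nbrs v (R.nl v) (R.nr v) := .inl ⟨rfl, rfl⟩
  refine ⟨color_ne hl h, ?_⟩
  rw [h.swap.view]
  exact color_ne hl h.swap

end Node
end Run
end FiveColoring
end AsyncLocal

/-! ### Displays change boundedly often. -/

namespace AsyncLocal
namespace FiveColoring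
open Disp
open scoped Classical

/-- The number of changes of `f` up to time `T`. -/
noncomputable def changes {α : Type*} (f : ℕ → α) (T : ℕ) : ℕ :=
  Nat.count (fun t => f (t + 1) ≠ f t) T

section Changes

variable {α β : Type*} {f : ℕ → α}

lemma changes_succ (f : ℕ → α) (t : ℕ) :
    changes f (t + 1) = changes f t + if f (t + 1) ≠ f t then 1 else 0 :=
  Nat.count_succ ..

lemma changes_mono (f : ℕ → α) : Monotone (changes f) := Nat.count_monotone _

lemma changes_succ_of_eq {t : ℕ} (h : f (t + 1) = f t) : changes f (t + 1) = changes f t := by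
  simp [changes_succ, h]

lemma changes_succ_le (f : ℕ → α) (t : ℕ) : changes f (t + 1) ≤ changes f t + 1 := by
  rw [changes_succ]; split_ifs <;> omega

lemma changes_lt {s t : ℕ} (hst : s ≤ t) (h : f s ≠ f t) : changes f s + 1 ≤ changes f t := by
  induction t, hst using Nat.le_induction with
  | base => exact absurd rfl h
  | succ t ht ih =>
    by_cases h1 : f (t + 1) = f t
    · rw [changes_succ_of_eq h1]
      exact ih (h1 ▸ h)
    · rw [changes_succ, if_pos h1]
      have := changes_mono f ht
      omega

lemma changes_prod_le (f : ℕ → α) (g : ℕ → β) (t : ℕ) :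
    changes (fun s => (f s, g s)) t ≤ changes f t + changes g t := by
  induction t with
  | zero => simp [changes]
  | succ t ih =>
    simp only [changes_succ]
    by_cases h1 : f (t + 1) = f t <;> by_cases h2 : g (t + 1) = g t <;> simp [h1, h2] <;> omega

end Changes

/-- Erase the entries of rank at least `ρ`. -/
noncomputable def mask (K ρ : ℕ) : Disp → Disp
  | absent => absent
  | done x => done x
  | live r => live ⟨r.key, if r.key < ρ then r.a else 0, if 2 * K - r.key < ρ then r.b else 0,
      if 2 * K + 1 < ρ then r.g else 0, if 2 * K + 2 + r.key < ρ then r.c else 0⟩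

section Mask

variable {K ρ k : ℕ} {d e : Disp}

lemma isSmall_mask : IsSmall k (mask K ρ d) ↔ IsSmall k d := by
  cases d <;> simp [mask, IsSmall]

lemma isLarge_mask : IsLarge k (mask K ρ d) ↔ IsLarge k d := by
  cases d <;> simp [mask, IsLarge]

lemma isDoneZero_mask : IsDoneZero (mask K ρ d) ↔ IsDoneZero d := by
  cases d <;> simp [mask, IsDoneZero]

lemma zeroA_mask (h : k ≤ ρ) : ZeroA k (mask K ρ d) ↔ ZeroA k d := by
  rcases d with _ | x | r
  · simp [mask, ZeroA]
  · simp [mask, ZeroA]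
  · simp only [mask, ZeroA]
    refine and_congr_right fun h1 => ?_
    rw [if_pos (by omega)]

lemma largeB_mask {j : ℕ} (h : 2 * K - k ≤ ρ) (hd : ∀ r, d = live r → r.key < K) :
    LargeB k j (mask K ρ d) ↔ LargeB k j d := by
  rcases d with _ | x | r
  · simp [mask, LargeB]
  · simp [mask, LargeB]
  · have := hd r rfl
    simp only [mask, LargeB]
    refine and_congr_right fun h1 => ?_
    rw [if_pos (by omega)]

lemma lowOne_mask (h : 2 * K < ρ) (hd : ∀ r, d = live r → r.key < K) :
    LowOne (mask K ρ d) ↔ LowOne d := by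
  rcases d with _ | x | r
  · simp [mask, LowOne]
  · simp [mask, LowOne]
  · have := hd r rfl
    simp only [mask, LowOne]
    rw [if_pos (by omega), if_pos (by omega)]

lemma lowZero_mask (h : 2 * K < ρ) (hd : ∀ r, d = live r → r.key < K) :
    LowZero (mask K ρ d) ↔ LowZero d := by
  rcases d with _ | x | r
  · simp [mask, LowZero]
  · simp [mask, LowZero]
  · have := hd r rfl
    simp only [mask, LowZero]
    rw [if_pos (by omega), if_pos (by omega)]

lemma left_mask (h : 2 * K + 1 < ρ) : (mask K ρ d).left = d.left := by
  cases d <;> simp [mask, left, h]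

lemma color_mask (h : 2 * K + 2 + k ≤ ρ) (hd : IsSmall k d) :
    (mask K ρ d).color = d.color := by
  rcases d with _ | x | r
  · simp [mask, color]
  · simp [mask, color]
  · simp only [IsSmall] at hd
    simp only [mask, color]
    rw [if_pos (by omega)]

lemma aVal_mask (h : k ≤ ρ) : aVal k (mask K ρ d) (mask K ρ e) = aVal k d e := by
  simp only [aVal, isSmall_mask, zeroA_mask h]

lemma bVal_mask (h : 2 * K - k ≤ ρ) (hd : ∀ r, d = live r → r.key < K)
    (he : ∀ r, e = live r → r.key < K) :
    bVal k (mask K ρ d) (mask K ρ e) = bVal k d e := by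
  simp only [bVal, largeB_mask h hd, largeB_mask h he]

lemma gVal_mask (hk : k < K) (h : 2 * K < ρ) (hd : ∀ r, d = live r → r.key < K)
    (he : ∀ r, e = live r → r.key < K) :
    gVal k (mask K ρ d) (mask K ρ e) = gVal k d e := by
  simp only [gVal, isSmall_mask, isDoneZero_mask, lowOne_mask h hd, lowOne_mask h he,
    lowZero_mask h hd, lowZero_mask h he, aVal_mask (show k ≤ ρ by omega)]

lemma cVal_mask (hk : k < K) (h : 2 * K + 2 + k ≤ ρ) (hd : ∀ r, d = live r → r.key < K)
    (he : ∀ r, e = live r → r.key < K) :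
    cVal k (mask K ρ d) (mask K ρ e) = cVal k d e := by
  have h1 : 2 * K + 1 < ρ := by omega
  have h2 : 2 * K - k ≤ ρ := by omega
  have hp : ∀ {d}, (IsSmall k d ∧ (mask K ρ d).color = some 1 ↔
      IsSmall k d ∧ d.color = some 1) :=
    and_congr_right fun hs => by rw [color_mask h hs]
  simp only [cVal, isSmall_mask, isLarge_mask, hp, left_mask h1, largeB_mask h2 hd,
    aVal_mask (show k ≤ ρ by omega), bVal_mask h2 hd he, gVal_mask hk (show 2 * K < ρ by omega) hd he]
  by_cases hs : IsSmall k d ∧ IsSmall k e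
  · rw [if_pos hs, if_pos hs, color_mask h hs.1, color_mask h hs.2]
  · simp only [hs, if_false]

/-- The ranks of a, b, g, c are key, 2K − key, 2K + 1 and 2K + 2 + key. Here a uses a of smaller
neighbors, b uses b of larger ones, g uses a and b, and c uses a, b, g and the colors of smaller
neighbors. So every entry depends only on entries of strictly lower rank. -/
lemma mask_succ_mkRec (hk : k < K) (hd : ∀ r, d = live r → r.key < K)
    (he : ∀ r, e = live r → r.key < K) :
    mask K (ρ + 1) (live (mkRec k (mask K ρ d) (mask K ρ e))) =
      mask K (ρ + 1) (live (mkRec k d e)) := by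
  have h1 : k < ρ + 1 → aVal k (mask K ρ d) (mask K ρ e) = aVal k d e :=
    fun h => aVal_mask (Nat.lt_succ_iff.1 h)
  have h2 : 2 * K - k < ρ + 1 → bVal k (mask K ρ d) (mask K ρ e) = bVal k d e :=
    fun h => bVal_mask (Nat.lt_succ_iff.1 h) hd he
  have h3 : 2 * K + 1 < ρ + 1 → gVal k (mask K ρ d) (mask K ρ e) = gVal k d e :=
    fun h => gVal_mask hk (Nat.lt_succ_iff.1 h) hd he
  have h4 : 2 * K + 2 + k < ρ + 1 → cVal k (mask K ρ d) (mask K ρ e) = cVal k d e :=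
    fun h => cVal_mask hk (Nat.lt_succ_iff.1 h) hd he
  generalize mask K ρ d = d' at *
  generalize mask K ρ e = e' at *
  simp only [mask, mkRec, live.injEq, Rec.mk.injEq, true_and]
  exact ⟨if_ctx_congr Iff.rfl h1 fun _ => rfl, if_ctx_congr Iff.rfl h2 fun _ => rfl,
    if_ctx_congr Iff.rfl h3 fun _ => rfl, if_ctx_congr Iff.rfl h4 fun _ => rfl⟩

lemma mask_eq_self (hd : ∀ r, d = live r → r.key < K) : mask K (3 * K + 3) d = d := by
  rcases d with _ | x | r
  · rfl
  · rfl
  · have := hd r rfl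
    simp only [mask]
    rw [if_pos (by omega), if_pos (by omega), if_pos (by omega), if_pos (by omega)]

end Mask

namespace Run
variable {V : Type} {R : Run V}

lemma readTime_succ {v : V} {t : ℕ} (h : v ∈ R.S t) : R.readTime v (t + 1) = t + 1 := by
  rw [readTime, if_pos h]

lemma D_key_lt (v : V) (t : ℕ) : ∀ r, R.D v t = live r → r.key < R.bound := fun r h => by
  rw [R.D_live_key h]; exact R.key_lt v

/-- If a function of the record of `v` is determined by a function of the view of `v`, then the
displayed value changes at most two times more often. -/
lemma changes_D_le {β γ : Type*} (v : V) (m : Disp → γ) (p : ℕ → β)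
    (hp : ∀ s t, p s = p t → m (live (R.view v s)) = m (live (R.view v t))) (t : ℕ) :
    changes (fun t => m (R.D v t)) t ≤ 2 + changes p t := by
  set f := fun t => m (R.P v t) with hf
  -- The two extra changes are the passages from absent to live and from live to terminated. In
  -- between, the value can change only if `p` differs between two readings.
  have hP : ∀ t, (R.P v t = absent → changes f t = 0) ∧
      (∀ r, R.P v t = live r → changes f t ≤ 1 + changes p (R.readTime v t)) ∧
      changes f t ≤ 2 + changes p (R.readTime v t) := by
    intro t
    induction t with
    | zero => simp [changes, R.P_zero]
    | succ t ih =>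
      have hm := changes_mono p (R.readTime_mono v (Nat.le_add_right t 1))
      rcases R.P_cases v t with h | ⟨hS, h, hx⟩ | ⟨hS, r, h, h'⟩
      · have h1 : f (t + 1) = f t := by simp only [hf, h]
        rw [changes_succ_of_eq h1, h]
        refine ⟨ih.1, fun r hr => ?_, ?_⟩
        · have := ih.2.1 r hr
          omega
        · omega
      · have key : changes f (t + 1) ≤ 1 + changes p (R.readTime v (t + 1)) := by
          rcases h1 : R.P v t with _ | x | r
          · have h2 := ih.1 h1
            have := changes_succ_le f t
            omega
          · exact absurd h1 (hx x)
          · have h2 := ih.2.1 r h1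
            by_cases h3 : f (t + 1) = f t
            · rw [changes_succ_of_eq h3]; omega
            · have h4 := changes_succ_le f t
              have h5 : p (R.readTime v t) ≠ p (R.readTime v (t + 1)) := by
                intro h6
                apply h3
                simp only [hf, h, h1]
                rw [R.P_live_view h1, hp _ _ h6, readTime_succ hS]
              have := changes_lt (R.readTime_mono v (Nat.le_add_right t 1)) h5
              omega
        refine ⟨fun h1 => by simp [h] at h1, fun _ _ => key, by omega⟩
      · have h1 := ih.2.1 r h
        have h2 := changes_succ_le f t
        refine ⟨fun h3 => by simp [h'] at h3, fun r' h3 => by simp [h'] at h3, by omega⟩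
  have hD : ∀ t, changes (fun t => m (R.D v t)) t ≤ changes f (R.writeTime v t) := by
    intro t
    induction t with
    | zero => simp [changes]
    | succ t ih =>
      have hle := R.writeTime_mono v (Nat.le_add_right t 1)
      by_cases h : m (R.D v (t + 1)) = m (R.D v t)
      · rw [changes_succ_of_eq (f := fun t => m (R.D v t)) h]
        exact ih.trans (changes_mono f hle)
      · have h1 := changes_succ_le (fun t => m (R.D v t)) t
        have h2 : f (R.writeTime v t) ≠ f (R.writeTime v (t + 1)) := by
          simp only [hf, ← R.D_eq_P]
          exact Ne.symm h
        have := changes_lt hle h2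
        omega
  calc _ ≤ changes f (R.writeTime v t) := hD t
    _ ≤ 2 + changes p (R.readTime v (R.writeTime v t)) := (hP _).2.2
    _ ≤ 2 + changes p t := by
      have := changes_mono p (R.viewTime_le v t)
      simp only [viewTime] at this
      omega

/-- A bound for the number of changes of the displayed entries of rank less than `ρ`. -/
def changeBound : ℕ → ℕ
  | 0 => 2
  | ρ + 1 => 2 + (changeBound ρ + changeBound ρ)

lemma changes_mask_le (ρ : ℕ) (v : V) (t : ℕ) :
    changes (fun t => mask R.bound ρ (R.D v t)) t ≤ changeBound ρ := by
  induction ρ generalizing v t with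
  | zero =>
    refine (changes_D_le v (mask R.bound 0) (fun _ => ()) (fun s t _ => ?_) t).trans ?_
    · simp [mask, view, mkRec]
    · simp [changes, changeBound]
  | succ ρ ih =>
    refine (changes_D_le v (mask R.bound (ρ + 1)) (fun t => (mask R.bound ρ (R.D (R.nl v) t),
      mask R.bound ρ (R.D (R.nr v) t))) (fun s t h => ?_) t).trans ?_
    · rw [Prod.mk.injEq] at h
      simp only [view]
      rw [← mask_succ_mkRec (R.key_lt v) (D_key_lt _ _) (D_key_lt _ _), h.1, h.2,
        mask_succ_mkRec (R.key_lt v) (D_key_lt _ _) (D_key_lt _ _)]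
    · have := changes_prod_le (fun t => mask R.bound ρ (R.D (R.nl v) t))
        (fun t => mask R.bound ρ (R.D (R.nr v) t)) t
      have h1 := ih (R.nl v) t
      have h2 := ih (R.nr v) t
      simp only [changeBound]
      omega

lemma changes_D_bound (v : V) (t : ℕ) :
    changes (R.D v) t ≤ changeBound (3 * R.bound + 3) := by
  have h := changes_mask_le (R := R) (3 * R.bound + 3) v t
  simpa only [mask_eq_self (D_key_lt _ _)] using h

/-- A node is activated a bounded number of times with a pending live display. -/
lemma count_live_le (v : V) (t : ℕ) :
    Nat.count (fun t => v ∈ R.S t ∧ ∃ r, R.P v t = live r) t ≤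
      1 + (changeBound (3 * R.bound + 3) + changeBound (3 * R.bound + 3)) := by
  set p := fun t => (R.D (R.nl v) t, R.D (R.nr v) t) with hp
  set q := fun t => v ∈ R.S t ∧ ∃ r, R.P v t = live r with hq
  have key : (R.P v t = absent → Nat.count q t = 0) ∧
      (∀ r, R.P v t = live r → Nat.count q t ≤ changes p (R.readTime v t)) ∧
      Nat.count q t ≤ 1 + changes p (R.readTime v t) := by
    induction t with
    | zero => simp [R.P_zero]
    | succ t ih =>
      have hrt := R.readTime_mono v (Nat.le_add_right t 1)
      have hm := changes_mono p hrt
      by_cases hqt : q t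
      · obtain ⟨hS, r, hr⟩ := hqt
        have h1 := ih.2.1 r hr
        have h2 : Nat.count q (t + 1) = Nat.count q t + 1 := by
          rw [Nat.count_succ, if_pos ⟨hS, r, hr⟩]
        have h3 := R.P_live v t r hS hr
        refine ⟨fun h4 => ?_, fun r' hr' => ?_, by omega⟩
        · rw [h4] at h3; split_ifs at h3
        -- With unchanged neighbors, the current view would reproduce `r`, whose color is then free
        -- by `view_color_ne`, and `v` would terminate.
        · have h5 : p (R.readTime v t) ≠ p (R.readTime v (t + 1)) := by
            intro h6
            rw [readTime_succ hS] at h6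
            have h7 : r = R.view v (t + 1) := by
              rw [R.P_live_view hr]
              simp only [hp, Prod.mk.injEq] at h6
              simp only [view, h6]
            have h9 := view_color_ne ((R.D_write v t hS).trans hr)
            rw [h7, if_pos h9, hr'] at h3
            simp at h3
          have := changes_lt hrt h5
          omega
      · have h2 : Nat.count q (t + 1) = Nat.count q t := by
          rw [Nat.count_succ, if_neg hqt, add_zero]
        rw [h2]
        rcases R.P_cases v t with h | ⟨hS, h, hx⟩ | ⟨hS, r, h, h'⟩
        · rw [h]
          exact ⟨ih.1, fun r hr => (ih.2.1 r hr).trans hm, by omega⟩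
        · rcases h1 : R.P v t with _ | x | r
          · have := ih.1 h1
            exact ⟨fun h4 => by simp [h] at h4, fun _ _ => by omega, by omega⟩
          · exact absurd h1 (hx x)
          · exact absurd ⟨hS, r, h1⟩ hqt
        · exact absurd ⟨hS, r, h⟩ hqt
  have h1 := changes_mono p (R.readTime_le v t)
  have h2 := changes_prod_le (R.D (R.nl v)) (R.D (R.nr v)) t
  have h3 := changes_D_bound (R := R) (R.nl v) t
  have h4 := changes_D_bound (R := R) (R.nr v) t
  have h5 := key.2.2
  change changes p t ≤ _ at h2
  change Nat.count q t ≤ _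
  omega

end Run
end FiveColoring
end AsyncLocal

/-! ### Arithmetic and combinatorics of the color reduction. -/

namespace AsyncLocal
namespace FiveColoring

/-- The number of bits of the colors after one step of color reduction from `B` bits. -/
def bits (B : ℕ) : ℕ := 2 * Nat.clog 2 B + 2

lemma two_mul_add_four_le {m : ℕ} (hm : 4 ≤ m) : 2 * m + 4 ≤ 2 ^ m := by
  induction m, hm using Nat.le_induction with
  | base => norm_num
  | succ m _ ih => rw [pow_succ]; omega

/-- Ten is a fixed point of `bits`, which is why the reduction stops there. -/
lemma bits_lt {B : ℕ} (h : 10 < B) : bits B < B := by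
  have h1 : B ≤ 2 ^ ((B - 3) / 2) :=
    le_trans (by omega) (two_mul_add_four_le (m := (B - 3) / 2) (by omega))
  have := Nat.clog_le_of_le_pow h1
  unfold bits
  omega

/-- The number of steps of color reduction that lead from `B` bits to at most ten bits. -/
def rounds (B : ℕ) : ℕ := if h : B ≤ 10 then 0 else rounds (bits B) + 1
termination_by B
decreasing_by exact bits_lt (by omega)

lemma rounds_of_le {B : ℕ} (h : B ≤ 10) : rounds B = 0 := by rw [rounds, dif_pos h]

lemma rounds_of_lt {B : ℕ} (h : 10 < B) : rounds B = rounds (bits B) + 1 := by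
  rw [rounds, dif_neg (by omega)]

lemma bits_iterate_rounds (B : ℕ) : bits^[rounds B] B ≤ 10 := by
  induction B using Nat.strong_induction_on with
  | _ B ih =>
    rcases Nat.lt_or_ge 10 B with h | h
    · rw [rounds_of_lt h, Function.iterate_succ_apply]
      exact ih _ (bits_lt h)
    · rwa [rounds_of_le h]

lemma rounds_le_self (B : ℕ) : rounds B ≤ B := by
  induction B using Nat.strong_induction_on with
  | _ B ih =>
    rcases Nat.lt_or_ge 10 B with h | h
    · rw [rounds_of_lt h]
      have := ih _ (bits_lt h)
      have := bits_lt h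
      omega
    · simp [rounds_of_le h]

lemma clog_lt {y : ℕ} (h : 1 < y) : Nat.clog 2 y < y := by
  have h1 : y ≤ 2 ^ (y - 1) := by
    have := Nat.lt_two_pow_self (n := y - 1)
    omega
  have := Nat.clog_le_of_le_pow h1
  omega

lemma add_three_le_two_pow {m : ℕ} (hm : 3 ≤ m) : m + 3 ≤ 2 ^ m := by
  induction m, hm using Nat.le_induction with
  | base => norm_num
  | succ m _ ih => rw [pow_succ]; omega

/-- The factor `D` absorbs the constants in `bits`, so one reduction step corresponds to one
logarithm of `y`. -/
lemma bits_le_mul_clog {D B y : ℕ} (hD : 8 ≤ D) (hy : 3 ≤ y) (h : B ≤ D * y) :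
    bits B ≤ D * Nat.clog 2 y := by
  have h1 : Nat.clog 2 B ≤ Nat.clog 2 D + Nat.clog 2 y := by
    refine Nat.clog_le_of_le_pow (h.trans ?_)
    rw [pow_add]
    exact Nat.mul_le_mul (Nat.le_pow_clog (by norm_num) _) (Nat.le_pow_clog (by norm_num) _)
  have h2 : Nat.clog 2 D ≤ D - 3 := by
    refine Nat.clog_le_of_le_pow ?_
    have := add_three_le_two_pow (m := D - 3) (by omega)
    omega
  have h3 : 2 ≤ Nat.clog 2 y := by
    rw [← Nat.lt_iff_add_one_le, Nat.lt_clog_iff_pow_lt (by norm_num)]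
    omega
  obtain ⟨l, hl⟩ := Nat.exists_eq_add_of_le h3
  obtain ⟨D', rfl⟩ := Nat.exists_eq_add_of_le hD
  unfold bits
  rw [hl] at h1 ⊢
  have h4 : Nat.clog 2 (8 + D') ≤ 5 + D' := by omega
  nlinarith [Nat.zero_le (D' * l)]

lemma rounds_le_logStar {D B y : ℕ} (hD : 8 ≤ D) (h : B ≤ D * y) :
    rounds B ≤ logStar y + 2 * D := by
  induction y using Nat.strong_induction_on generalizing B with
  | _ y ih =>
    rcases Nat.lt_or_ge y 3 with hy | hy
    -- At most 2D bits are left, and each remaining step removes at least one.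
    · have := rounds_le_self B
      have : D * y ≤ D * 2 := Nat.mul_le_mul_left D (by omega)
      omega
    · rcases Nat.lt_or_ge 10 B with hB | hB
      · have := ih _ (clog_lt (by omega)) (bits_le_mul_clog hD hy h)
        rw [rounds_of_lt hB, logStar, if_neg (by omega)]
        omega
      · simp [rounds_of_le hB]

/-- From n ≤ 2^n. A linear bound on the number of bits suffices, because `rounds_le_logStar` needs
only a multiple of n. -/
lemma size_le_mul {n N k : ℕ} (hn : 1 ≤ n) (h : N ≤ n ^ k) : N.size ≤ (k + 8) * n := by
  have h1 : N.size ≤ n * k + 1 := by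
    rw [Nat.size_le, pow_succ, pow_mul]
    have h2 : n ^ k ≤ (2 ^ n) ^ k := Nat.pow_le_pow_left Nat.lt_two_pow_self.le k
    have h3 : 0 < (2 ^ n) ^ k := by positivity
    omega
  nlinarith

lemma one_le_logStar {n : ℕ} (h : 3 ≤ n) : 1 ≤ logStar n := by
  rw [logStar, if_neg (by omega)]; omega

/-- The pair of positions `i` and `j` together with the bits of `x` at these positions. -/
def code (B i j x : ℕ) : ℕ :=
  ((i * B + j) * 2 + (x.testBit i).toNat) * 2 + (x.testBit j).toNat

/-- The candidates for the new color of a node with color `x < 2 ^ B`. -/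
def Cand (B x e : ℕ) : Prop := ∃ i j, i < B ∧ j < B ∧ e = code B i j x

lemma code_inj {B i j i' j' x y : ℕ} (hj : j < B) (hj' : j' < B)
    (h : code B i j x = code B i' j' y) :
    i = i' ∧ j = j' ∧ x.testBit i = y.testBit i' ∧ x.testBit j = y.testBit j' := by
  unfold code at h
  have b1 := Bool.toNat_lt (x.testBit i)
  have b2 := Bool.toNat_lt (x.testBit j)
  have b3 := Bool.toNat_lt (y.testBit i')
  have b4 := Bool.toNat_lt (y.testBit j')
  have h1 : i * B + j = i' * B + j' := by omega
  have inj : ∀ b c : Bool, b.toNat = c.toNat → b = c := by decide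
  have h2 := inj (x.testBit i) (y.testBit i') (by omega)
  have h3 := inj (x.testBit j) (y.testBit j') (by omega)
  have hB : 0 < B := by omega
  have h4 : i = i' := by
    have := congrArg (· / B) h1
    simp only [mul_comm _ B, Nat.mul_add_div hB, Nat.div_eq_of_lt hj, Nat.div_eq_of_lt hj'] at this
    omega
  subst h4
  exact ⟨rfl, by omega, h2, h3⟩

lemma code_lt {B i j x : ℕ} (hi : i < B) (hj : j < B) : code B i j x < 2 ^ bits B := by
  have b1 := Bool.toNat_lt (x.testBit i)
  have b2 := Bool.toNat_lt (x.testBit j)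
  have h1 : B ≤ 2 ^ Nat.clog 2 B := Nat.le_pow_clog (by norm_num) B
  have h2 : 2 ^ bits B = 2 ^ Nat.clog 2 B * 2 ^ Nat.clog 2 B * 4 := by
    rw [bits, two_mul, pow_add, pow_add]; norm_num
  have h3 : B * B ≤ 2 ^ Nat.clog 2 B * 2 ^ Nat.clog 2 B := Nat.mul_le_mul h1 h1
  have h4 : (i + 1) * B ≤ B * B := Nat.mul_le_mul_right B hi
  rw [h2]
  unfold code
  rw [add_mul] at h4
  omega

lemma exists_testBit_ne {B x y : ℕ} (hx : x < 2 ^ B) (hy : y < 2 ^ B) (h : x ≠ y) :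
    ∃ i < B, x.testBit i ≠ y.testBit i := by
  obtain ⟨i, hi⟩ := Nat.exists_testBit_ne_of_ne h
  refine ⟨i, ?_, hi⟩
  by_contra! hc
  have h1 : 2 ^ B ≤ 2 ^ i := Nat.pow_le_pow_right (by norm_num) hc
  exact hi (by rw [Nat.testBit_lt_two_pow (hx.trans_le h1), Nat.testBit_lt_two_pow (hy.trans_le h1)])

/-- A color reduction step is possible if there are at most two different colors to avoid. -/
lemma exists_cand {B x y z : ℕ} {Y : Set ℕ} (hB : 0 < B) (hx : x < 2 ^ B)
    (hY : ∀ y ∈ Y, y < 2 ^ B ∧ x ≠ y) (hyz : ∀ y' ∈ Y, y' = y ∨ y' = z) :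
    ∃ e, e < 2 ^ bits B ∧ Cand B x e ∧ ∀ y' ∈ Y, ¬ Cand B y' e := by
  have key : ∀ y, ∃ i < B, y ∈ Y → x.testBit i ≠ y.testBit i := by
    intro y
    by_cases hy : y ∈ Y
    · obtain ⟨i, hi, h⟩ := exists_testBit_ne hx (hY y hy).1 (hY y hy).2
      exact ⟨i, hi, fun _ => h⟩
    · exact ⟨0, hB, fun h => absurd h hy⟩
  -- Position `i` separates `x` from `y` and `j` separates it from `z`. A code determines its
  -- positions and bits, so it is a candidate for neither.
  obtain ⟨i, hi, h1⟩ := key y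
  obtain ⟨j, hj, h2⟩ := key z
  refine ⟨code B i j x, code_lt hi hj, ⟨i, j, hi, hj, rfl⟩, ?_⟩
  rintro y' hy' ⟨i', j', hi', hj', h⟩
  obtain ⟨rfl, rfl, h3, h4⟩ := code_inj hj hj' h
  rcases hyz y' hy' with rfl | rfl
  · exact h1 hy' h3
  · exact h2 hy' h4

open scoped Classical in
/-- A new color for a node with color `x` whose neighbors have colors in `Y`. -/
noncomputable def recolor (B x : ℕ) (Y : Set ℕ) : ℕ :=
  if h : ∃ e, e < 2 ^ bits B ∧ Cand B x e ∧ ∀ y ∈ Y, ¬ Cand B y e then h.choose else 0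

lemma recolor_spec {B x y z : ℕ} {Y : Set ℕ} (hB : 0 < B) (hx : x < 2 ^ B)
    (hY : ∀ y ∈ Y, y < 2 ^ B ∧ x ≠ y) (hyz : ∀ y' ∈ Y, y' = y ∨ y' = z) :
    recolor B x Y < 2 ^ bits B ∧ Cand B x (recolor B x Y) ∧
      ∀ y' ∈ Y, ¬ Cand B y' (recolor B x Y) := by
  have h := exists_cand hB hx hY hyz
  rw [recolor, dif_pos h]
  exact h.choose_spec

lemma encard_le_of_count_le {p : ℕ → Prop} [DecidablePred p] {M : ℕ}
    (h : ∀ t, Nat.count p t ≤ M) : {t | p t}.encard ≤ (M : ℕ∞) := by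
  by_contra! hc
  obtain ⟨s, hs, hcard⟩ := Set.exists_subset_encard_eq (Order.add_one_le_of_lt hc)
  have hfin : s.Finite := Set.finite_of_encard_eq_coe (k := M + 1) hcard
  obtain ⟨b, hb⟩ := hfin.bddAbove
  have h1 := h (b + 1)
  rw [Nat.count_eq_card_filter_range] at h1
  have h2 : hfin.toFinset ⊆ (Finset.range (b + 1)).filter p := by
    intro t ht
    rw [Set.Finite.mem_toFinset] at ht
    simp only [Finset.mem_filter, Finset.mem_range]
    exact ⟨Nat.lt_succ_of_le (hb ht), hs ht⟩
  have h3 := (Finset.card_le_card h2).trans h1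
  rw [hfin.encard_eq_coe_toFinset_card] at hcard
  have h4 : hfin.toFinset.card = M + 1 := by exact_mod_cast hcard
  omega

end FiveColoring
end AsyncLocal

/-! ### The algorithm and the invariant of the color reduction. -/

namespace AsyncLocal
namespace FiveColoring
open Disp
open scoped Classical

/-- The local state of a node: the bound on the identifiers, the colors of the color reduction
so far, the number of steps of color reduction made, and the record shown, if any. -/
structure St where
  N : ℕ
  hist : ℕ → ℕ
  stage : ℕ
  shown : Option Rec

def dispOf : Option (NodeState St (Fin 5)) → Disp
  | some (.running s) => match s.shown with
    | some r => live r
    | none => absent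
  | some (.terminated x) => done x
  | none => absent

/-- The number of bits of the colors after `i` steps of color reduction. -/
def width (N i : ℕ) : ℕ := bits^[i] N.size

def stages (N : ℕ) : ℕ := rounds N.size

/-- The colors before step `i` of the color reduction that appear in the registers. -/
def seen (i : ℕ) (R : Set (Option (NodeState St (Fin 5)))) : Set ℕ :=
  {y | ∃ s : St, some (.running s) ∈ R ∧ i ≤ s.stage ∧ y = s.hist i}

/-- The record of a node with key `k` that reads the registers `R`. -/
noncomputable def recOf (k : ℕ) (R : Set (Option (NodeState St (Fin 5)))) : Rec :=
  if h : ∃ p : Disp × Disp, dispOf '' R = {p.1, p.2} then mkRec k h.choose.1 h.choose.2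
  else mkRec k absent absent

lemma recOf_eq {k : ℕ} {R : Set (Option (NodeState St (Fin 5)))} {d e : Disp}
    (h : dispOf '' R = {d, e}) : recOf k R = mkRec k d e := by
  have h1 : ∃ p : Disp × Disp, dispOf '' R = {p.1, p.2} := ⟨(d, e), h⟩
  rw [recOf, dif_pos h1]
  have h2 := h1.choose_spec
  generalize h1.choose = p at h2
  rw [h2, Set.pair_eq_pair_iff] at h
  rcases h with ⟨rfl, rfl⟩ | ⟨rfl, rfl⟩
  · rfl
  · exact mkRec_comm _ _ _

/-- A reduction step uses only those neighbors that have reached the stage; the others find this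
color in `hist` later. The default of `getD` is never used. -/
noncomputable def nextState (s : St) (R : Set (Option (NodeState St (Fin 5)))) :
    NodeState St (Fin 5) :=
  if s.stage < stages s.N then
    .running ⟨s.N, Function.update s.hist (s.stage + 1)
      (recolor (width s.N s.stage) (s.hist s.stage) (seen s.stage R)), s.stage + 1, s.shown⟩
  else if ∃ r, s.shown = some r ∧ ∀ q ∈ R, (dispOf q).color ≠ some r.c then
    .terminated ((s.shown.map Rec.c).getD 0)
  else .running ⟨s.N, s.hist, s.stage, some (recOf (s.hist (stages s.N)) R)⟩

/-- Entries of `hist` beyond `stage` are placeholders and are never read. -/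
noncomputable def algorithm : Algorithm ℕ (Fin 5) where
  State := St
  init i N := .running ⟨N, fun _ => i, 0, none⟩
  next := nextState

lemma nextState_running {s s' : St} {R} (h : nextState s R = .running s') :
    s'.N = s.N ∧ ((s.stage < stages s.N ∧ s'.stage = s.stage + 1 ∧ s'.shown = s.shown ∧
      s'.hist = Function.update s.hist (s.stage + 1)
        (recolor (width s.N s.stage) (s.hist s.stage) (seen s.stage R))) ∨
      (stages s.N ≤ s.stage ∧ s'.stage = s.stage ∧ s'.hist = s.hist ∧
        s'.shown = some (recOf (s.hist (stages s.N)) R))) := by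
  unfold nextState at h
  split_ifs at h with h1 h2
  · cases NodeState.running.inj h
    exact ⟨rfl, .inl ⟨h1, rfl, rfl, rfl⟩⟩
  · cases NodeState.running.inj h
    exact ⟨rfl, .inr ⟨by omega, rfl, rfl, rfl⟩⟩

lemma nextState_hist {s s' : St} {R} (h : nextState s R = .running s') :
    s.stage ≤ s'.stage ∧ s'.stage ≤ s.stage + 1 ∧ ∀ i ≤ s.stage, s'.hist i = s.hist i := by
  rcases (nextState_running h).2 with ⟨-, h1, -, h2⟩ | ⟨-, h1, h2, -⟩
  · refine ⟨by omega, by omega, fun i hi => ?_⟩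
    rw [h2, Function.update_of_ne (by omega)]
  · exact ⟨by omega, by omega, fun i _ => by rw [h2]⟩

lemma width_pos {N : ℕ} (hN : 1 ≤ N) (i : ℕ) : 0 < width N i := by
  cases i with
  | zero => exact Nat.size_pos.2 hN
  | succ i => rw [width, Function.iterate_succ_apply']; unfold bits; omega

lemma width_succ (N i : ℕ) : width N (i + 1) = bits (width N i) :=
  Function.iterate_succ_apply' _ _ _

section Exec

variable {V : Type}

/-- The set of register contents that `v` reads when the nodes of `S` are activated. -/
def readings (G : SimpleGraph V) (S : Set V) (c : Config algorithm V) (v : V) :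
    Set (Option (NodeState St (Fin 5))) :=
  {q | ∃ u, G.Adj v u ∧ (algorithm.step G S c).old u = q}

variable {G : SimpleGraph V} {S : Set V} {c : Config algorithm V} {v : V}

lemma step_old_mem (h : v ∈ S) : (algorithm.step G S c).old v = some (c.new v) := by
  simp [Algorithm.step, h]

lemma step_old_notMem (h : v ∉ S) : (algorithm.step G S c).old v = c.old v := by
  simp [Algorithm.step, h]

lemma step_new_mem (h : v ∈ S) :
    (algorithm.step G S c).new v = algorithm.update (c.new v) (readings G S c v) := by
  simp only [Algorithm.step, if_pos h]
  rfl

lemma step_new_notMem (h : v ∉ S) : (algorithm.step G S c).new v = c.new v := by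
  simp [Algorithm.step, h]

lemma step_new_running {s : St} (h : v ∈ S) (hs : c.new v = .running s) :
    (algorithm.step G S c).new v = nextState s (readings G S c v) := by
  rw [step_new_mem h, hs]; rfl

lemma step_new_terminated {x : Fin 5} (hs : c.new v = .terminated x) :
    (algorithm.step G S c).new v = .terminated x := by
  by_cases h : v ∈ S
  · rw [step_new_mem h, hs]; rfl
  · rw [step_new_notMem h, hs]

lemma running_of_step {s' : St} (h : (algorithm.step G S c).new v = .running s') :
    ∃ s : St, c.new v = .running s ∧
      ((v ∉ S ∧ s' = s) ∨ (v ∈ S ∧ nextState s (readings G S c v) = .running s')) := by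
  rcases h1 : c.new v with s | x
  · refine ⟨s, rfl, ?_⟩
    by_cases hv : v ∈ S
    · exact .inr ⟨hv, (step_new_running hv h1).symm.trans h⟩
    · rw [step_new_notMem hv, h1] at h
      exact .inl ⟨hv, (NodeState.running.inj h).symm⟩
  · rw [step_new_terminated h1] at h
    simp at h

lemma hist_of_step {s' : St} (h : (algorithm.step G S c).new v = .running s') :
    ∃ s : St, c.new v = .running s ∧
      s.stage ≤ s'.stage ∧ s'.stage ≤ s.stage + 1 ∧ ∀ i ≤ s.stage, s'.hist i = s.hist i := by
  obtain ⟨s, h1, ⟨-, rfl⟩ | ⟨-, h2⟩⟩ := running_of_step h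
  · exact ⟨_, h1, le_rfl, by omega, fun _ _ => rfl⟩
  · exact ⟨s, h1, nextState_hist h2⟩

/-- The register of `v` holds `s`, or `s` is the current state of `v`. -/
def Has (c : Config algorithm V) (v : V) (s : St) : Prop :=
  c.old v = some (.running s) ∨ c.new v = .running s

structure Good (N : ℕ) (s : St) : Prop where
  N_eq : s.N = N
  stage_le : s.stage ≤ stages N
  lt : ∀ i ≤ s.stage, s.hist i < 2 ^ width N i
  cand : ∀ i < s.stage, Cand (width N i) (s.hist i) (s.hist (i + 1))
  shown : ∀ r, s.shown = some r → s.stage = stages N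

/-- Properness must also cover pending states, since they become visible later. A register lags
behind its node by at most one stage. -/
structure Inv (G : SimpleGraph V) (N : ℕ) (c : Config algorithm V) : Prop where
  good : ∀ v s, Has c v s → Good N s
  adj : ∀ u v s s', G.Adj u v → Has c u s → Has c v s' →
    ∀ i, i ≤ s.stage → i ≤ s'.stage → s.hist i ≠ s'.hist i
  unwritten : ∀ v s, c.old v = none → c.new v = .running s → s.stage = 0
  terminated : ∀ v x, c.old v = some (.terminated x) → c.new v = .terminated x
  running : ∀ v s s', c.old v = some (.running s) → c.new v = .running s' →
    s.stage ≤ s'.stage ∧ s'.stage ≤ s.stage + 1 ∧ ∀ i ≤ s.stage, s'.hist i = s.hist i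

lemma Has.of_step_old {s : St} (h : (algorithm.step G S c).old v = some (.running s)) :
    Has c v s := by
  by_cases hv : v ∈ S
  · rw [step_old_mem hv] at h
    exact .inr (Option.some.inj h)
  · rw [step_old_notMem hv] at h
    exact .inl h

lemma Has.of_step {s' : St} (h : Has (algorithm.step G S c) v s') :
    Has c v s' ∨ (v ∈ S ∧ ∃ s, c.new v = .running s ∧
      nextState s (readings G S c v) = .running s') := by
  rcases h with h | h
  · exact .inl (Has.of_step_old h)
  · obtain ⟨s, h1, ⟨-, rfl⟩ | ⟨h2, h3⟩⟩ := running_of_step h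
    · exact .inl (.inr h1)
    · exact .inr ⟨h2, s, h1, h3⟩

lemma Inv.recolor_spec {N : ℕ} (hc : Inv G N c) (hN : 1 ≤ N) {a b : V}
    (hab : ∀ u, G.Adj v u → u = a ∨ u = b) {s : St} (hs : c.new v = .running s) :
    let y := recolor (width N s.stage) (s.hist s.stage) (seen s.stage (readings G S c v))
    y < 2 ^ width N (s.stage + 1) ∧ Cand (width N s.stage) (s.hist s.stage) y ∧
      ∀ y' ∈ seen s.stage (readings G S c v), ¬ Cand (width N s.stage) y' y := by
  have hg := hc.good v s (.inr hs)
  let val : V → ℕ := fun u => match (algorithm.step G S c).old u with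
    | some (.running s0) => St.hist s0 s.stage
    | _ => 0
  rw [width_succ]
  refine FiveColoring.recolor_spec (y := val a) (z := val b) (width_pos hN _) (hg.lt _ le_rfl)
    ?_ ?_
  · rintro y ⟨s0, ⟨u, hu, h1⟩, h2, rfl⟩
    have h3 := Has.of_step_old h1
    exact ⟨(hc.good u s0 h3).lt _ h2, hc.adj v u s s0 hu (.inr hs) h3 _ le_rfl h2⟩
  · rintro y ⟨s0, ⟨u, hu, h1⟩, h2, rfl⟩
    have h3 : s0.hist s.stage = val u := by simp only [val, h1]
    rcases hab u hu with rfl | rfl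
    · exact .inl h3
    · exact .inr h3

lemma Inv.step {N : ℕ} (hc : Inv G N c) (hN : 1 ≤ N) {a b : V → V}
    (hab : ∀ v u, G.Adj v u → u = a v ∨ u = b v) (S : Set V) :
    Inv G N (algorithm.step G S c) := by
  have unwritten : ∀ v s, (algorithm.step G S c).old v = none →
      (algorithm.step G S c).new v = .running s → s.stage = 0 := by
    intro v s h1 h2
    by_cases hv : v ∈ S
    · rw [step_old_mem hv] at h1
      simp at h1
    · rw [step_old_notMem hv] at h1
      rw [step_new_notMem hv] at h2
      exact hc.unwritten v s h1 h2
  have terminated : ∀ v x, (algorithm.step G S c).old v = some (.terminated x) →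
      (algorithm.step G S c).new v = .terminated x := by
    intro v x h1
    by_cases hv : v ∈ S
    · rw [step_old_mem hv] at h1
      exact step_new_terminated (Option.some.inj h1)
    · rw [step_old_notMem hv] at h1
      exact step_new_terminated (hc.terminated v x h1)
  have running : ∀ v s s', (algorithm.step G S c).old v = some (.running s) →
      (algorithm.step G S c).new v = .running s' →
      s.stage ≤ s'.stage ∧ s'.stage ≤ s.stage + 1 ∧ ∀ i ≤ s.stage, s'.hist i = s.hist i := by
    intro v s s' h1 h2
    by_cases hv : v ∈ S
    · rw [step_old_mem hv] at h1
      obtain ⟨s1, h3, h4⟩ := hist_of_step h2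
      rw [h3] at h1
      cases NodeState.running.inj (Option.some.inj h1)
      exact h4
    · rw [step_old_notMem hv] at h1
      rw [step_new_notMem hv] at h2
      exact hc.running v s s' h1 h2
  have good : ∀ v s, Has (algorithm.step G S c) v s → Good N s := by
    intro v s' h
    rcases h.of_step with h | ⟨-, s, hs, h⟩
    · exact hc.good v s' h
    · have hg := hc.good v s (.inr hs)
      have hr := hc.recolor_spec hN (hab v) hs (S := S)
      obtain ⟨h1, ⟨h2, h3, h4, h5⟩ | ⟨h2, h3, h4, h5⟩⟩ := nextState_running h
      · rw [hg.N_eq] at h1 h2 h5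
        refine ⟨h1, by omega, fun i hi => ?_, fun i hi => ?_, fun r hr => ?_⟩
        · rw [h5]
          rcases Nat.lt_or_ge s.stage i with hi' | hi'
          · have : i = s.stage + 1 := by omega
            subst this
            rw [Function.update_self]
            exact hr.1
          · rw [Function.update_of_ne (by omega)]
            exact hg.lt i hi'
        · rw [h5, Function.update_of_ne (by omega)]
          rcases Nat.lt_or_ge i s.stage with hi' | hi'
          · rw [Function.update_of_ne (by omega)]
            exact hg.cand i hi'
          · have : i = s.stage := by omega
            subst this
            rw [Function.update_self]
            exact hr.2.1
        · rw [h4] at hr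
          have := hg.shown r hr
          omega
      · have := hg.stage_le
        rw [hg.N_eq] at h1 h2
        refine ⟨h1, by omega, ?_, ?_, fun r _ => by omega⟩
        · rw [h4, h3]; exact hg.lt
        · rw [h4, h3]; exact hg.cand
  -- The new color of `u` is a candidate for its color at the previous stage. That color is in the
  -- register of `u`, which lags by at most one stage, and `v` avoids all its candidates.
  have fresh : ∀ u v s s' s0, G.Adj u v → v ∈ S → c.new v = .running s →
      nextState s (readings G S c v) = .running s' → Has (algorithm.step G S c) u s0 →
      s.stage + 1 ≤ s'.stage → s.stage + 1 ≤ s0.stage →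
      s0.hist (s.stage + 1) ≠ s'.hist (s.stage + 1) := by
    intro u v s s' s0 huv hv hs h hu h1 h2
    have hg := hc.good v s (.inr hs)
    have hr := (hc.recolor_spec hN (hab v) hs (S := S)).2.2
    obtain ⟨-, ⟨-, h3, -, h5⟩ | ⟨-, h3, -⟩⟩ := nextState_running h
    · rw [hg.N_eq] at h5
      rw [h5, Function.update_self]
      intro h6
      have h7 := (good u s0 hu).cand s.stage (by omega)
      rw [h6] at h7
      refine hr (s0.hist s.stage) ?_ h7
      rcases hu with hu | hu
      · exact ⟨s0, ⟨u, huv.symm, hu⟩, by omega, rfl⟩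
      · rcases h8 : (algorithm.step G S c).old u with _ | ⟨s1⟩ | ⟨x⟩
        · have := unwritten u s0 h8 hu
          omega
        · have h9 := running u s1 s0 h8 hu
          exact ⟨s1, ⟨u, huv.symm, h8⟩, by omega, h9.2.2 _ (by omega)⟩
        · have := terminated u x h8
          rw [hu] at this
          simp at this
    · omega
  refine ⟨good, ?_, unwritten, terminated, running⟩
  intro u v s1 s2 huv h1 h2 i hi1 hi2
  rcases h1.of_step with k1 | ⟨m1, q1, k1, n1⟩ <;> rcases h2.of_step with k2 | ⟨m2, q2, k2, n2⟩
  · exact hc.adj u v s1 s2 huv k1 k2 i hi1 hi2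
  · have l2 := nextState_hist n2
    rcases Nat.lt_or_ge q2.stage i with hi | hi
    · have : i = q2.stage + 1 := by omega
      subst this
      exact fresh u v q2 s2 s1 huv m2 k2 n2 h1 hi2 hi1
    · rw [l2.2.2 i hi]
      exact hc.adj u v s1 q2 huv k1 (.inr k2) i hi1 hi
  · have l1 := nextState_hist n1
    rcases Nat.lt_or_ge q1.stage i with hi | hi
    · have : i = q1.stage + 1 := by omega
      subst this
      exact (fresh v u q1 s1 s2 huv.symm m1 k1 n1 h2 hi1 hi2).symm
    · rw [l1.2.2 i hi]
      exact hc.adj u v q1 s2 huv (.inr k1) k2 i hi hi2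
  · have l1 := nextState_hist n1
    have l2 := nextState_hist n2
    rcases Nat.lt_or_ge q2.stage i with hi | hi
    · have : i = q2.stage + 1 := by omega
      subst this
      exact fresh u v q2 s2 s1 huv m2 k2 n2 h1 hi2 hi1
    · rcases Nat.lt_or_ge q1.stage i with hi' | hi'
      · have : i = q1.stage + 1 := by omega
        subst this
        exact (fresh v u q1 s1 s2 huv.symm m1 k1 n1 h2 hi1 hi2).symm
      · rw [l1.2.2 i hi', l2.2.2 i hi]
        exact hc.adj u v q1 q2 huv (.inr k1) (.inr k2) i hi' hi

lemma Inv.exec {N : ℕ} {ident : V → ℕ} (hid : ValidIds N ident) {a b : V → V}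
    (hab : ∀ v u, G.Adj v u → u = a v ∨ u = b v) (S : ℕ → Set V) (t : ℕ) :
    Inv G N (algorithm.exec G ident (fun _ => N) S t) := by
  induction t with
  | zero =>
    have h : ∀ v s, Has (algorithm.exec G ident (fun _ => N) S 0) v s →
        s = ⟨N, fun _ => ident v, 0, none⟩ := by
      rintro v s (h | h)
      · simp [Algorithm.exec] at h
      · exact (NodeState.running.inj h).symm
    refine ⟨fun v s hs => ?_, fun u v s s' huv hs hs' i hi hi' => ?_, fun v s _ hs => ?_,
      fun v x h => ?_, fun v s s' h => ?_⟩
    · cases h v s hs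
      refine ⟨rfl, Nat.zero_le _, fun i hi => ?_, fun i hi => by simp at hi, by simp⟩
      obtain rfl : i = 0 := by simpa using hi
      exact (hid.2 v).2.trans_lt (Nat.lt_size_self N)
    · cases h u s hs
      cases h v s' hs'
      exact fun h' => huv.ne (hid.1 h')
    · rw [h v s (.inr hs)]
    · simp [Algorithm.exec] at h
    · simp [Algorithm.exec] at h
  | succ t ih =>
    by_cases hV : Nonempty V
    · obtain ⟨v⟩ := hV
      exact ih.step ((hid.2 v).1.trans (hid.2 v).2) hab (S t)
    · have he : ∀ v : V, False := fun v => hV ⟨v⟩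
      exact ⟨fun v => (he v).elim, fun v => (he v).elim, fun v => (he v).elim,
        fun v => (he v).elim, fun v => (he v).elim⟩

end Exec
end FiveColoring
end AsyncLocal

/-! ### From executions of the algorithm to the runtime bound. -/

namespace AsyncLocal
namespace FiveColoring
open Disp
open scoped Classical

section Exec

variable {V : Type} {G : SimpleGraph V} {N : ℕ} {ident : V → ℕ} {S : ℕ → Set V}

lemma hist_of_exec {v : V} {t t' : ℕ} (htt : t ≤ t') {s s' : St}
    (h : (algorithm.exec G ident (fun _ => N) S t).new v = .running s)
    (h' : (algorithm.exec G ident (fun _ => N) S t').new v = .running s') :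
    s.stage ≤ s'.stage ∧ ∀ i ≤ s.stage, s'.hist i = s.hist i := by
  induction t', htt using Nat.le_induction generalizing s' with
  | base =>
    rw [h] at h'
    cases NodeState.running.inj h'
    exact ⟨le_rfl, fun _ _ => rfl⟩
  | succ t' _ ih =>
    obtain ⟨s1, h1, h2, -, h3⟩ := hist_of_step h'
    obtain ⟨h4, h5⟩ := ih h1
    exact ⟨h4.trans h2, fun i hi => (h3 i (hi.trans h4)).trans (h5 i hi)⟩

lemma Has.exec {v : V} {t : ℕ} {s : St}
    (h : Has (algorithm.exec G ident (fun _ => N) S t) v s) :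
    ∃ t', (algorithm.exec G ident (fun _ => N) S t').new v = .running s := by
  rcases h with h | h
  · induction t with
    | zero => simp [Algorithm.exec] at h
    | succ t ih =>
      rcases Has.of_step_old h with h1 | h1
      · exact ih h1
      · exact ⟨t, h1⟩
  · exact ⟨t, h⟩

/-- The last color of `v` in the color reduction. -/
noncomputable def finalKey (G : SimpleGraph V) (N : ℕ) (ident : V → ℕ) (S : ℕ → Set V)
    (v : V) : ℕ :=
  if h : ∃ s : St, (∃ t, (algorithm.exec G ident (fun _ => N) S t).new v = .running s) ∧
    s.stage = stages N then h.choose.hist (stages N) else 0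

/-- Entries of the history are never rewritten, so all states at the last stage agree on the key. -/
lemma finalKey_eq {v : V} {t : ℕ} {s : St}
    (h : Has (algorithm.exec G ident (fun _ => N) S t) v s) (hs : s.stage = stages N) :
    finalKey G N ident S v = s.hist (stages N) := by
  obtain ⟨t1, h1⟩ := h.exec
  have hex : ∃ s : St, (∃ t, (algorithm.exec G ident (fun _ => N) S t).new v = .running s) ∧
    s.stage = stages N := ⟨s, ⟨t1, h1⟩, hs⟩
  rw [finalKey, dif_pos hex]
  obtain ⟨⟨t2, h2⟩, h3⟩ := hex.choose_spec
  generalize hex.choose = q at h2 h3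
  rcases le_total t1 t2 with ht | ht
  · exact (hist_of_exec ht h1 h2).2 _ hs.ge
  · exact ((hist_of_exec ht h2 h1).2 _ h3.ge).symm

lemma exists_of_dispOf_live {q : Option (NodeState St (Fin 5))} {r : Rec}
    (h : dispOf q = live r) : ∃ s : St, q = some (.running s) ∧ s.shown = some r := by
  rcases q with _ | ⟨s⟩ | x
  · simp [dispOf] at h
  · refine ⟨s, rfl, ?_⟩
    rcases hs : s.shown with _ | r'
    · simp [dispOf, hs] at h
    · simpa [dispOf, hs] using h
  · simp [dispOf] at h

lemma eq_of_dispOf_done {n : NodeState St (Fin 5)} {x : Fin 5}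
    (h : dispOf (some n) = done x) : n = .terminated x := by
  rcases n with s | y
  · rcases hs : s.shown with _ | r' <;> simp [dispOf, hs] at h
  · simpa [dispOf] using h

lemma exists_of_dispOf_absent {n : NodeState St (Fin 5)}
    (h : dispOf (some n) = absent) : ∃ s : St, n = .running s ∧ s.shown = none := by
  rcases n with s | y
  · refine ⟨s, rfl, ?_⟩
    rcases hs : s.shown with _ | r'
    · rfl
    · simp [dispOf, hs] at h
  · simp [dispOf] at h

lemma dispOf_image_readings {nl nr : V → V} (hG : ∀ v u, G.Adj v u ↔ u = nl v ∨ u = nr v)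
    (S : Set V) (c : Config algorithm V) (v : V) :
    dispOf '' readings G S c v = {dispOf ((algorithm.step G S c).old (nl v)),
      dispOf ((algorithm.step G S c).old (nr v))} := by
  ext d
  constructor
  · rintro ⟨q, ⟨u, hu, rfl⟩, rfl⟩
    rcases (hG v u).1 hu with rfl | rfl
    · exact .inl rfl
    · exact .inr rfl
  · rintro (rfl | rfl)
    · exact ⟨_, ⟨_, (hG v _).2 (.inl rfl), rfl⟩, rfl⟩
    · exact ⟨_, ⟨_, (hG v _).2 (.inr rfl), rfl⟩, rfl⟩

/-- The displays of the nodes in an execution. -/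
noncomputable def runOf {nl nr : V → V} (hG : ∀ v u, G.Adj v u ↔ u = nl v ∨ u = nr v)
    (hid : ValidIds N ident) (S : ℕ → Set V) : Run V where
  S := S
  nl := nl
  nr := nr
  key := finalKey G N ident S
  bound := 2 ^ 10
  D v t := dispOf ((algorithm.exec G ident (fun _ => N) S t).old v)
  P v t := dispOf (some ((algorithm.exec G ident (fun _ => N) S t).new v))
  D_zero _ := rfl
  P_zero _ := rfl
  D_idle v t h := by rw [Algorithm.exec, step_old_notMem h]
  P_idle v t h := by rw [Algorithm.exec, step_new_notMem h]
  D_write v t h := congrArg dispOf (step_old_mem h)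
  P_done v t x _ h := by
    rw [Algorithm.exec, step_new_terminated (eq_of_dispOf_done h)]
    rfl
  P_absent v t hv h := by
    obtain ⟨s, hs, hs'⟩ := exists_of_dispOf_absent h
    have hinv := Inv.exec hid (fun v u => (hG v u).1) S t
    have hg := hinv.good v s (.inr hs)
    rw [Algorithm.exec, step_new_running hv hs, nextState, hg.N_eq]
    split_ifs with h1 h2
    · left
      simp [dispOf, hs']
    · simp [hs'] at h2
    · right
      have h3 : s.stage = stages N := le_antisymm hg.stage_le (by omega)
      rw [finalKey_eq (.inr hs) h3, recOf_eq (dispOf_image_readings hG (S t) _ v)]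
      rfl
  P_live v t r hv h := by
    obtain ⟨s, hs, hs'⟩ := exists_of_dispOf_live h
    replace hs := Option.some.inj hs
    have hinv := Inv.exec hid (fun v u => (hG v u).1) S t
    have hg := hinv.good v s (.inr hs)
    have h3 : s.stage = stages N := hg.shown r hs'
    have him := dispOf_image_readings hG (S t) (algorithm.exec G ident (fun _ => N) S t) v
    have h4 : (∃ r, s.shown = some r ∧ ∀ q ∈ readings G (S t)
        (algorithm.exec G ident (fun _ => N) S t) v, (dispOf q).color ≠ some r.c) ↔
        (dispOf ((algorithm.step G (S t) (algorithm.exec G ident (fun _ => N) S t)).old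
          (nl v))).color ≠ some r.c ∧
        (dispOf ((algorithm.step G (S t) (algorithm.exec G ident (fun _ => N) S t)).old
          (nr v))).color ≠ some r.c := by
      have h5 : ∀ q : Disp, q ∈ dispOf '' readings G (S t)
        (algorithm.exec G ident (fun _ => N) S t) v ↔ _ := fun q => by rw [him]
      constructor
      · rintro ⟨r', h6, h7⟩
        rw [hs'] at h6
        cases Option.some.inj h6
        exact ⟨h7 _ ⟨_, (hG _ _).2 (.inl rfl), rfl⟩, h7 _ ⟨_, (hG _ _).2 (.inr rfl), rfl⟩⟩
      · rintro ⟨h6, h7⟩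
        refine ⟨r, hs', ?_⟩
        rintro q ⟨u, hu, rfl⟩
        rcases (hG _ _).1 hu with rfl | rfl
        · exact h6
        · exact h7
    rw [Algorithm.exec, step_new_running hv hs, nextState, hg.N_eq, if_neg (by omega)]
    by_cases h5 : (dispOf ((algorithm.step G (S t)
        (algorithm.exec G ident (fun _ => N) S t)).old (nl v))).color ≠ some r.c ∧
        (dispOf ((algorithm.step G (S t) (algorithm.exec G ident (fun _ => N) S t)).old
          (nr v))).color ≠ some r.c
    · rw [if_pos h5, if_pos (h4.2 h5), hs']
      rfl
    · rw [if_neg h5, if_neg (fun h => h5 (h4.1 h)), finalKey_eq (.inr hs) h3, recOf_eq him]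
      rfl
  key_lt v := by
    rw [finalKey]
    split_ifs with h
    · obtain ⟨⟨t, h1⟩, h2⟩ := h.choose_spec
      generalize h.choose = s at h1 h2
      have hg := (Inv.exec hid (fun v u => (hG v u).1) S t).good v s (.inr h1)
      exact (hg.lt _ h2.ge).trans_le
        (Nat.pow_le_pow_right (by norm_num) (bits_iterate_rounds N.size))
    · norm_num
  symm u v h := (hG u v).1 ((hG v u).2 h).symm
  key_ne u v t r q huv hu hv := by
    obtain ⟨s, hs, hs'⟩ := exists_of_dispOf_live hu
    obtain ⟨p, hp, hp'⟩ := exists_of_dispOf_live hv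
    have hinv := Inv.exec hid (fun v u => (hG v u).1) S t
    have h1 := (hinv.good u s (.inl hs)).shown r hs'
    have h2 := (hinv.good v p (.inl hp)).shown q hp'
    rw [finalKey_eq (.inl hs) h1, finalKey_eq (.inl hp) h2]
    exact hinv.adj u v s p ((hG v u).2 huv).symm (.inl hs) (.inl hp) _ h1.ge h2.ge

lemma properlyColors {nl nr : V → V} (hG : ∀ v u, G.Adj v u ↔ u = nl v ∨ u = nr v)
    (hid : ValidIds N ident) (S : ℕ → Set V) :
    algorithm.ProperlyColors G ident (fun _ => N) S := by
  intro t u v x y huv hu hv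
  refine (runOf hG hid S).done_ne (t := t) ((hG v u).1 huv.symm) ?_ ?_
  · exact congrArg (fun n => dispOf (some n)) hu
  · exact congrArg (fun n => dispOf (some n)) hv

/-- A node is activated only a few times before it shows a record. -/
lemma count_absent_le {nl nr : V → V} (hG : ∀ v u, G.Adj v u ↔ u = nl v ∨ u = nr v)
    (hid : ValidIds N ident) (S : ℕ → Set V) (v : V) (t : ℕ) :
    Nat.count (fun t => v ∈ S t ∧ (runOf hG hid S).P v t = absent) t ≤ stages N + 1 := by
  set p := fun t => v ∈ S t ∧ (runOf hG hid S).P v t = absent with hp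
  -- Each counted activation raises the stage, except the last one, which creates the record.
  have key : (∀ s : St, (algorithm.exec G ident (fun _ => N) S t).new v = .running s →
      Nat.count p t ≤ s.stage + if s.shown = none then 0 else 1) ∧
      Nat.count p t ≤ stages N + 1 := by
    induction t with
    | zero => simp
    | succ t ih =>
      have hinv := Inv.exec hid (fun v u => (hG v u).1) S t
      by_cases hpt : p t
      · obtain ⟨hS, hP⟩ := hpt
        obtain ⟨s, hs, hs'⟩ := exists_of_dispOf_absent hP
        have hg := hinv.good v s (.inr hs)
        have h1 := ih.1 s hs
        rw [if_pos hs'] at h1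
        have := hg.stage_le
        rw [Nat.count_succ, if_pos ⟨hS, hP⟩]
        refine ⟨fun s' h2 => ?_, by omega⟩
        rw [Algorithm.exec, step_new_running hS hs] at h2
        obtain ⟨-, ⟨-, h3, -⟩ | ⟨-, h3, -, h4⟩⟩ := nextState_running h2
        · omega
        · rw [h4, if_neg (by simp)]
          omega
      · rw [Nat.count_succ, if_neg hpt, add_zero]
        refine ⟨fun s' h2 => ?_, ih.2⟩
        obtain ⟨s, hs, ⟨-, rfl⟩ | ⟨hS, h3⟩⟩ := running_of_step h2
        · exact ih.1 _ hs
        · have h1 := ih.1 s hs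
          have hsh : s.shown ≠ none := fun h => hpt ⟨hS, by
            change dispOf (some _) = _
            rw [hs]
            simp [dispOf, h]⟩
          rw [if_neg hsh] at h1
          obtain ⟨-, ⟨-, h4, h5, -⟩ | ⟨-, h4, -, h5⟩⟩ := nextState_running h3
          · rw [h5, if_neg hsh]
            omega
          · rw [h5, if_neg (by simp)]
            omega
  exact key.2

lemma runtime_le {nl nr : V → V} (hG : ∀ v u, G.Adj v u ↔ u = nl v ∨ u = nr v)
    (hid : ValidIds N ident) (S : ℕ → Set V) (v : V) {M : ℕ}
    (hM : Run.changeBound (3 * 2 ^ 10 + 3) = M) :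
    algorithm.runtime G ident (fun _ => N) S v ≤ ((stages N + 2 + 2 * M : ℕ) : ℕ∞) := by
  have h1 := encard_le_of_count_le (count_absent_le hG hid S v)
  have h2 : {t | v ∈ S t ∧ ∃ r, (runOf hG hid S).P v t = live r}.encard ≤
      ((1 + (M + M) : ℕ) : ℕ∞) := by
    refine encard_le_of_count_le fun t => ?_
    rw [← hM]
    exact (runOf hG hid S).count_live_le v t
  clear hM
  calc algorithm.runtime G ident (fun _ => N) S v
      ≤ ({t | v ∈ S t ∧ (runOf hG hid S).P v t = absent} ∪
        {t | v ∈ S t ∧ ∃ r, (runOf hG hid S).P v t = live r}).encard := by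
        refine Set.encard_le_encard ?_
        rintro t ⟨hS, ht⟩
        rcases h : (runOf hG hid S).P v t with _ | x | r
        · exact .inl ⟨hS, h⟩
        · exact absurd (eq_of_dispOf_done h) (ht x)
        · exact .inr ⟨hS, r, h⟩
    _ ≤ _ := Set.encard_union_le _ _
    _ ≤ ((stages N + 1 : ℕ) : ℕ∞) + ((1 + (M + M) : ℕ) : ℕ∞) := add_le_add h1 h2
    _ = ((stages N + 2 + 2 * M : ℕ) : ℕ∞) := by
      rw [← Nat.cast_add]
      congr 1
      omega

end Exec

lemma cycleGraph_adj_iff {n : ℕ} (hn : 3 ≤ n) : ∃ nl nr : Fin n → Fin n,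
    ∀ v u, (SimpleGraph.cycleGraph n).Adj v u ↔ u = nl v ∨ u = nr v := by
  obtain ⟨m, rfl⟩ := Nat.exists_eq_add_of_le' (show 2 ≤ n by omega)
  refine ⟨fun v => v - 1, fun v => v + 1, fun v u => ?_⟩
  rw [SimpleGraph.cycleGraph_adj]
  refine or_congr ⟨fun h => ?_, fun h => ?_⟩ ⟨fun h => ?_, fun h => ?_⟩
  · change u = v - 1
    rw [← h, sub_sub_cancel]
  · rw [h, sub_sub_cancel]
  · change u = v + 1
    rw [← h, add_sub_cancel]
  · rw [h, add_sub_cancel_left]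

end FiveColoring
end AsyncLocal

theorem corollary1 :
    ∃ A : AsyncLocal.Algorithm ℕ (Fin 5),
      (∀ (n N : ℕ) (ident : Fin n → ℕ) (S : ℕ → Set (Fin n)), 3 ≤ n →
        AsyncLocal.ValidIds N ident →
        A.ProperlyColors (SimpleGraph.cycleGraph n) ident (fun _ => N) S) ∧
      ∀ k : ℕ, ∃ C : ℕ, ∀ (n N : ℕ) (ident : Fin n → ℕ) (S : ℕ → Set (Fin n)), 3 ≤ n →
        N ≤ n ^ k → AsyncLocal.ValidIds N ident →
        ∀ v : Fin n,
          A.runtime (SimpleGraph.cycleGraph n) ident (fun _ => N) S v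
            ≤ ((C * AsyncLocal.logStar n : ℕ) : ℕ∞) := by
  -- The constant is 2^3077 − 2, so it is kept opaque. The argument 3 * 2 ^ 10 + 3 exceeds every
  -- rank, as keys are below 2 ^ 10.
  obtain ⟨M, hM⟩ : ∃ M, AsyncLocal.FiveColoring.Run.changeBound (3 * 2 ^ 10 + 3) = M :=
    ⟨_, rfl⟩
  refine ⟨AsyncLocal.FiveColoring.algorithm, fun n N ident S hn hid => ?_, fun k =>
    ⟨1 + 2 * (k + 8) + 2 + 2 * M, fun n N ident S hn hN hid v => ?_⟩⟩
  · obtain ⟨nl, nr, hG⟩ := AsyncLocal.FiveColoring.cycleGraph_adj_iff hn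
    exact AsyncLocal.FiveColoring.properlyColors hG hid S
  · obtain ⟨nl, nr, hG⟩ := AsyncLocal.FiveColoring.cycleGraph_adj_iff hn
    refine (AsyncLocal.FiveColoring.runtime_le hG hid S v hM).trans ?_
    have h1 : AsyncLocal.FiveColoring.stages N ≤ AsyncLocal.logStar n + 2 * (k + 8) :=
      AsyncLocal.FiveColoring.rounds_le_logStar (by omega)
        (AsyncLocal.FiveColoring.size_le_mul (by omega) hN)
    have h2 := AsyncLocal.FiveColoring.one_le_logStar hn
    refine Nat.cast_le.2 ?_
    have h3 : 2 * (k + 8) + 2 + 2 * M ≤ (2 * (k + 8) + 2 + 2 * M) * AsyncLocal.logStar n :=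
      Nat.le_mul_of_pos_right _ h2
    calc _ ≤ AsyncLocal.logStar n + (2 * (k + 8) + 2 + 2 * M) := by omega
      _ ≤ _ := by
        rw [show 1 + 2 * (k + 8) + 2 + 2 * M = 1 + (2 * (k + 8) + 2 + 2 * M) by ring, add_mul,
          one_mul]
        omega
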